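/- Let $(X_i,Y_i)$, $i=1,2,\dots$, be i.i.d. pairs of jointly measurable real-valued processes on $[0,1]$, and write $(X,Y)=(X_1,Y_1)$. Assume that $X$ and $Y$ are independent, $\mathbb E[X(t)]=\mathbb E[Y(t)]=0$ and $\mathbb E[X(t)^2]+\mathbb E[Y(t)^2]<\infty$ for every $t\in[0,1]$, and (A1) there are $\gamma_X,\gamma_Y>0$ and $c>0$ with $\operatorname{var}(X(t)-X(s))\le c|t-s|^{\gamma_X}$ and $\operatorname{var}(Y(t)-Y(s))\le c|t-s|^{\gamma_Y}$ for all $0\le s<t\le 1$. For every $n$ let $0=t_0<t_1<\dots<t_p=1$ ($p=p_n$, $t_i=t_{n,i}$) be a partition of $[0,1]$ with mesh $\delta_n=\max_{1\le i\le p}(t_i-t_{i-1})$. Assume that either (a) $\sum_{n\ge1}\delta_n^{\gamma_X\wedge\gamma_Y}<\infty$, or (b) there are $\widetilde\gamma_X,\widetilde\gamma_Y>0$ and $c>0$ with $\mathbb E|X(t)-X(s)|^4\le c|t-s|^{\widetilde\gamma_X}$ and $\mathbb E|Y(t)-Y(s)|^4\le c|t-s|^{\widetilde\gamma_Y}$ for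 all $s,t\in[0,1]$, and $\sum_{n\ge1}\big(\delta_n^{2(\gamma_X\wedge\gamma_Y)}+n^{-1}\delta_n^{\widetilde\gamma_X\wedge\widetilde\gamma_Y}\big)<\infty$. Put $Z_i=(X_i,Y_i)$ and $Z_i^{(p)}=(X_i^{(p)},Y_i^{(p)})$, where $x^{(p)}(t)=\sum_{i=1}^p x(t_i)\mathbf 1(t\in(t_{i-1},t_i])$ for a path $x$ on $[0,1]$; paths are regarded as elements of $L^2[0,1]$ with norm $\|\cdot\|_2$. For $z_i=(x_i,y_i)\in L^2[0,1]\times L^2[0,1]$ let $$f(z_1,z_2,z_3,z_4)=\|x_1-x_2\|_2\|y_1-y_2\|_2+\|x_1-x_2\|_2\|y_3-y_4\|_2-2\|x_1-x_2\|_2\|y_1-y_3\|_2,$$ let $h(z_1,z_2,z_3,z_4)=\frac1{24}\sum_\sigma f(z_{\sigma(1)},z_{\sigma(2)},z_{\sigma(3)},z_{\sigma(4)})$ be its symmetrization over all permutations $\sigma$ of $\{1,2,3,4\}$, and for a probability law $H$ on $L^2[0,1]\times L^2[0,1]$ and $W_1,\dots,W_4$ i.i.d. with law $H$ let $$h_2(z,z';H)=\mathbb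 E\,h(z,z',W_3,W_4)-\mathbb E\,h(z,W_2,W_3,W_4)-\mathbb E\,h(W_1,z',W_3,W_4)+\mathbb E\,h(W_1,W_2,W_3,W_4).$$ Let $F_Z$ be the law of $Z_1$ and $$U_n(Z)=\frac1n\sum_{1\le i\ne j\le n}h_2(Z_i,Z_j;F_Z).$$ Let $F_{n,Z^{(p)}}$ be the empirical law of $Z_1^{(p)},\dots,Z_n^{(p)}$, let $Z^{(p)*}_{n1},\dots,Z^{(p)*}_{nn}$ be, given the sample $(Z_i)$, i.i.d. with law $F_{n,Z^{(p)}}$, and let $$U_n(Z^{(p)*})=\frac1n\sum_{1\le i\ne j\le n}h_2\big(Z^{(p)*}_{ni},Z^{(p)*}_{nj};F_{n,Z^{(p)}}\big),$$ whose law $\mathcal L(U_n(Z^{(p)*}))$ is taken conditionally on the sample. For laws $F,G$ on $\mathbb R$ let $d_2(F,G)=\inf(\mathbb E|A-B|^2)^{1/2}$, the infimum over all pairs $(A,B)$ of random variables with $\mathcal L(A)=F$ and $\mathcal L(B)=G$. Then, for almost every realization of $(Z_i)$, $$d_2\big(\mathcal L(U_n(Z)),\mathcal L(U_n(Z^{(p)*}))\big)\to0\qquad(n\to\infty).$$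 -/

import Mathlib

open MeasureTheory ProbabilityTheory Filter Topology
open scoped ENNReal

noncomputable section

namespace DistCov

/-! ### The path space -/

/-- The Hilbert space `L²[0,1]` (Lebesgue measure), with its Borel σ-algebra. -/
abbrev L2I : Type := Lp ℝ 2 (volume : Measure unitInterval)

instance : MeasurableSpace L2I := borel L2I

instance : BorelSpace L2I := ⟨rfl⟩

instance : SecondCountableTopology L2I :=
  haveI : Fact ((2 : ℝ≥0∞) ≠ ∞) := ⟨ENNReal.ofNat_ne_top⟩
  Lp.SecondCountableTopology

/-- The state space of the pairs `z = (x, y)`. -/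
abbrev PathPair : Type := L2I × L2I

/-- The element of `L²[0,1]` given by a path `x : [0,1] → ℝ`
(the value `0` is used for a path that is not square-integrable). -/
def toL2 (x : unitInterval → ℝ) : L2I :=
  open Classical in
  if h : MemLp x 2 (volume : Measure unitInterval) then h.toLp x else 0

/-- The pair of paths `(x, y)` as a point of the state space. -/
def pathPair (x y : unitInterval → ℝ) : PathPair := (toL2 x, toL2 y)

/-! ### Partitions and discretized paths -/

/-- A partition `0 = t₀ < t₁ < ⋯ < t_p = 1` of `[0,1]`. -/
structure UnitPartition where
  /-- The number of intervals of the partition. -/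
  p : ℕ
  /-- The partition points. -/
  t : Fin (p + 1) → unitInterval
  strictMono : StrictMono t
  first : t 0 = 0
  last : t (Fin.last p) = 1

/-- The mesh `max_{1 ≤ i ≤ p} (t_i - t_{i-1})`. -/
def UnitPartition.mesh (P : UnitPartition) : ℝ :=
  ⨆ i : Fin P.p, ((P.t i.succ : ℝ) - (P.t i.castSucc : ℝ))

/-- The discretized path `x^{(p)}(s) = ∑_{i=1}^p x(t_i) 1(s ∈ (t_{i-1}, t_i])`. -/
def UnitPartition.discretize (P : UnitPartition) (x : unitInterval → ℝ) : unitInterval → ℝ :=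
  fun s => ∑ i : Fin P.p,
    (Set.Ioc (P.t i.castSucc) (P.t i.succ)).indicator (fun _ => x (P.t i.succ)) s

/-! ### Kernels and `U`-statistics -/

/-- The kernel `f(z₁, z₂, z₃, z₄)` of the sample distance covariance with `β = 1`;
the indices `1, 2, 3, 4` are `0, 1, 2, 3` here. -/
def kernelF (z : Fin 4 → PathPair) : ℝ :=
  ‖(z 0).1 - (z 1).1‖ * ‖(z 0).2 - (z 1).2‖
    + ‖(z 0).1 - (z 1).1‖ * ‖(z 2).2 - (z 3).2‖
    - 2 * (‖(z 0).1 - (z 1).1‖ * ‖(z 0).2 - (z 2).2‖)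

/-- The symmetrization `h` of `f`. -/
def kernelH (z : Fin 4 → PathPair) : ℝ :=
  (1 / 24 : ℝ) * ∑ σ : Equiv.Perm (Fin 4), kernelF (fun i => z (σ i))

/-- The law of `k` independent random elements with common law `H`. -/
abbrev iidLaw {S : Type*} [MeasurableSpace S] (H : Measure S) (k : ℕ) : Measure (Fin k → S) :=
  Measure.pi fun _ : Fin k => H

/-- The degenerate kernel of order two attached to the kernel `h` and the law `H`:
`h₂(x, y; H) = E h(x, y, Z₃, Z₄) - E h(x, Z₂, Z₃, Z₄) - E h(Z₁, y, Z₃, Z₄) + E h(Z₁, Z₂, Z₃, Z₄)`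
with `Z₁, Z₂, Z₃, Z₄` independent with common law `H`. -/
def kernelH2 (H : Measure PathPair) (x y : PathPair) : ℝ :=
  (∫ z, kernelH ![x, y, z 0, z 1] ∂(iidLaw H 2))
    - (∫ z, kernelH ![x, z 0, z 1, z 2] ∂(iidLaw H 3))
    - (∫ z, kernelH ![z 0, y, z 1, z 2] ∂(iidLaw H 3))
    + ∫ z, kernelH z ∂(iidLaw H 4)

/-- The normalized degenerate `U`-statistic
`n⁻¹ ∑_{1 ≤ i ≠ j ≤ n} h₂(z_i, z_j; H)`. -/
def uStat (H : Measure PathPair) (n : ℕ) (z : Fin n → PathPair) : ℝ :=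
  (n : ℝ)⁻¹ * ∑ ij ∈ (Finset.univ : Finset (Fin n)).offDiag, kernelH2 H (z ij.1) (z ij.2)

/-- The empirical law `n⁻¹ ∑_{i=1}^n δ_{z_i}` of the sample `z₁, …, z_n`. -/
def empiricalLaw {S : Type*} [MeasurableSpace S] {n : ℕ} (z : Fin n → S) : Measure S :=
  (n : ℝ≥0∞)⁻¹ • ∑ i : Fin n, Measure.dirac (z i)

/-- The conditional law, given the sample `z₁, …, z_n`, of the bootstrap statistic
`n⁻¹ ∑_{1 ≤ i ≠ j ≤ n} h₂(z*_i, z*_j; F_n)`, where `F_n` is the empirical law of the sample and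
`z*_1, …, z*_n` are independent with common law `F_n`. -/
def bootstrapLaw {n : ℕ} (z : Fin n → PathPair) : Measure ℝ :=
  (iidLaw (empiricalLaw z) n).map (uStat (empiricalLaw z) n)

/-! ### The Wasserstein (Mallows) distance -/

/-- The distance `d₂(F, G) = inf (E |A - B|²)^{1/2}`, the infimum over all pairs `(A, B)` of real
random variables with `A` of law `F` and `B` of law `G`; `π` is the joint law of `(A, B)`. -/
def mallows (F G : Measure ℝ) : ℝ≥0∞ :=
  ⨅ (π : Measure (ℝ × ℝ)) (_ : π.map Prod.fst = F ∧ π.map Prod.snd = G),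
    (∫⁻ ab, ENNReal.ofReal (|ab.1 - ab.2| ^ 2) ∂π) ^ (1 / 2 : ℝ)

/-! ### Conditions on the processes -/

variable {Ω : Type*} [MeasurableSpace Ω]

/-- `var(X(t) - X(s)) ≤ c |t - s|^γ` for `s < t`, for some constant `c > 0`. -/
def VarIncrementBound (μ : Measure Ω) (X : unitInterval → Ω → ℝ) (γ : ℝ) : Prop :=
  ∃ c : ℝ, 0 < c ∧ ∀ s t : unitInterval, s < t →
    variance (fun ω => X t ω - X s ω) μ ≤ c * |(t : ℝ) - (s : ℝ)| ^ γ

/-- `E |X(t) - X(s)|⁴ ≤ c |t - s|^γ` for all `s, t`, for some constant `c > 0`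
(the fourth moments being finite). -/
def FourthIncrementBound (μ : Measure Ω) (X : unitInterval → Ω → ℝ) (γ : ℝ) : Prop :=
  ∃ c : ℝ, 0 < c ∧ ∀ s t : unitInterval,
    Integrable (fun ω => |X t ω - X s ω| ^ 4) μ ∧
      ∫ ω, |X t ω - X s ω| ^ 4 ∂μ ≤ c * |(t : ℝ) - (s : ℝ)| ^ γ

end DistCov

end

/-! Write F for the law of the path pair and G for the empirical law of the discretized sample. The
distance between the laws of the two U-statistics is bounded by a quadratic transport cost between F
and G, uniformly in n; that cost is then shown to vanish almost surely.

For the first half, let π be a coupling of F and G and draw n independent pairs from it. The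
difference of the two U-statistics is again a U-statistic, whose kernel is the projection under π of
the difference of `kernelH` at the two components. This projection is degenerate, so distinct index
pairs are orthogonal and the normalized second moment is at most twice that of the kernel
(`integral_sum_offDiag_sq_le`). The kernel is controlled by second moments alone: after
symmetrization each distance may be replaced by ‖x - y‖ - ‖x‖ - ‖y‖ (`kernelH_eq`), which is bounded
by twice the norm of either endpoint. Increments of `kernelH` are therefore bounded by products of a
displacement and a size at two different, hence independent, variables (`abs_kernelH_sub_le`), and
no fourth moment appears. The outcome is `mallows_uStat_le`: squared distance at most a constant
times the product of the mean squares of `gap` and `size`.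

For the second half, a simple function T quantizes the state space. A maximal coupling of the cell
frequencies under F and under the sample, the strong law for these frequencies and for the
quantization error, and an average squared discretization error tending to zero give couplings of
vanishing cost (`ae_exists_coupling_empiricalLaw`). The discretization average vanishes by
summability of its first moments in case (a), of its second moments in case (b)
(`ae_tendsto_average_zero`).

The trajectories are i.i.d. for the product σ-algebra, for which passing from a trajectory to its
class in L² need not be measurable. `exists_measurable_factor` recovers the L² classes, up to null
sets, as one measurable function of the trajectories, namely a limit of discretizations. -/

namespace DistCov

/-! ### Reduced distances and a Lipschitz bound for the kernel. -/

/-- The distance in a normed group, reduced by the norms of the two points. -/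
noncomputable def reducedDist {V : Type*} [NormedAddCommGroup V] (x y : V) : ℝ := ‖x - y‖ - ‖x‖ - ‖y‖

section ReducedDist

variable {V : Type*} [NormedAddCommGroup V]

lemma abs_reducedDist_le_left (x y : V) : |reducedDist x y| ≤ 2 * ‖x‖ := by
  have h1 := norm_sub_norm_le y x
  have h2 := norm_sub_le x y
  rw [norm_sub_rev] at h1
  rw [reducedDist, abs_le]
  constructor <;> linarith [norm_nonneg x]

lemma abs_reducedDist_le_right (x y : V) : |reducedDist x y| ≤ 2 * ‖y‖ := by
  have h1 := norm_sub_norm_le x y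
  have h2 := norm_sub_le x y
  rw [reducedDist, abs_le]
  constructor <;> linarith [norm_nonneg y]

lemma abs_reducedDist_sub_le (x y x' y' : V) :
    |reducedDist x y - reducedDist x' y'| ≤ 2 * (‖x - x'‖ + ‖y - y'‖) := by
  have h1 : |‖x - y‖ - ‖x' - y'‖| ≤ ‖x - x'‖ + ‖y - y'‖ := by
    refine (abs_norm_sub_norm_le _ _).trans ?_
    rw [show x - y - (x' - y') = (x - x') - (y - y') by abel]
    exact norm_sub_le _ _
  have h2 := abs_norm_sub_norm_le x x'
  have h3 := abs_norm_sub_norm_le y y'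
  rw [abs_le] at h1 h2 h3
  rw [reducedDist, reducedDist, abs_le]
  constructor <;> linarith

end ReducedDist

/-- The kernel `kernelF` with the distances replaced by the reduced distances. -/
noncomputable def reducedKernel (z : Fin 4 → PathPair) : ℝ :=
  reducedDist (z 0).1 (z 1).1 * reducedDist (z 0).2 (z 1).2
    + reducedDist (z 0).1 (z 1).1 * reducedDist (z 2).2 (z 3).2
    - 2 * (reducedDist (z 0).1 (z 1).1 * reducedDist (z 0).2 (z 2).2)

lemma sum_perm_comp_mul {E : Type*} (φ : (Fin 4 → E) → ℝ) (z : Fin 4 → E)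
    (τ : Equiv.Perm (Fin 4)) :
    ∑ σ : Equiv.Perm (Fin 4), φ (fun i => z (σ (τ i)))
      = ∑ σ : Equiv.Perm (Fin 4), φ (fun i => z (σ i)) :=
  Fintype.sum_equiv (Equiv.mulRight τ) _ _ fun _ => rfl

/-- In the combination 01 + 23 - 2·02 of `kernelF`, any term depending on a single point in one of
the two distances cancels once the indices are averaged. Subtracting the norms therefore leaves the
symmetrization unchanged. -/
lemma kernelH_eq (z : Fin 4 → PathPair) :
    kernelH z = (1 / 24 : ℝ) * ∑ σ : Equiv.Perm (Fin 4), reducedKernel (fun i => z (σ i)) := by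
  rw [kernelH]
  congr 1
  rw [← sub_eq_zero, ← Finset.sum_sub_distrib]
  have symm : ∀ x y : L2I, reducedDist x y = reducedDist y x := fun x y => by
    rw [reducedDist, reducedDist, norm_sub_rev]; ring
  -- This permutation identifies, under the sum, the term with norm at 1 and distance 02 with the
  -- term with norm at 0 and distance 23.
  let c : Equiv.Perm (Fin 4) := Equiv.swap 0 1 * Equiv.swap 1 2 * Equiv.swap 1 3
  have hc : c 0 = 1 ∧ c 2 = 0 ∧ c 3 = 2 := by decide
  have h01 : Equiv.swap (0 : Fin 4) 1 2 = 2 ∧ Equiv.swap (0 : Fin 4) 1 3 = 3 := by decide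
  have h23 : Equiv.swap (2 : Fin 4) 3 0 = 0 ∧ Equiv.swap (2 : Fin 4) 3 1 = 1 := by decide
  have h12 : Equiv.swap (1 : Fin 4) 2 0 = 0 := by decide
  have e1 := sum_perm_comp_mul
    (fun v : Fin 4 → PathPair => ‖(v 0).1 - (v 1).1‖ * ‖(v 0).2‖) z (Equiv.swap 0 1)
  have e2 := sum_perm_comp_mul
    (fun v : Fin 4 → PathPair => ‖(v 0).1 - (v 1).1‖ * ‖(v 2).2‖) z (Equiv.swap 2 3)
  have e3 := sum_perm_comp_mul
    (fun v : Fin 4 → PathPair => ‖(v 0).1‖ * reducedDist (v 0).2 (v 1).2) z (Equiv.swap 0 1)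
  have e4 := sum_perm_comp_mul
    (fun v : Fin 4 → PathPair => ‖(v 0).1‖ * reducedDist (v 0).2 (v 1).2) z (Equiv.swap 1 2)
  have e5 := sum_perm_comp_mul
    (fun v : Fin 4 → PathPair => ‖(v 0).1‖ * reducedDist (v 2).2 (v 3).2) z (Equiv.swap 0 1)
  have e6 := sum_perm_comp_mul
    (fun v : Fin 4 → PathPair => ‖(v 0).1‖ * reducedDist (v 2).2 (v 3).2) z c
  simp only [Equiv.swap_apply_left, Equiv.swap_apply_right, h01.1, h01.2, h23.1, h23.2, h12,
    hc.1, hc.2.1, hc.2.2] at e1 e2 e3 e4 e5 e6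
  rw [← sub_eq_zero, ← Finset.sum_sub_distrib] at e1 e2 e3 e4 e5 e6
  -- The coefficients are chosen so that the summand is exactly `kernelF - reducedKernel`.
  have key := congrArg₂ (· + ·) (congrArg₂ (· + ·) e1 e2)
    (congrArg₂ (· - ·) (congrArg₂ (· + ·) e3 e5) (congrArg (2 * ·) (congrArg₂ (· + ·) e4 e6)))
  simp only [Finset.mul_sum, ← Finset.sum_add_distrib, ← Finset.sum_sub_distrib] at key
  rw [show (0 : ℝ) + 0 + (0 + 0 - 2 * (0 + 0)) = 0 by norm_num] at key
  rw [← key]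
  refine Finset.sum_congr rfl fun σ _ => ?_
  unfold kernelF reducedKernel
  rw [symm (z (σ 1)).2 (z (σ 0)).2, norm_sub_rev (z (σ 1)).1 (z (σ 0)).1]
  simp only [reducedDist]
  ring

/-- The off-diagonal product sum `∑_{p ≠ q} δ(w_p) s(w_q)`. -/
noncomputable def crossSum {E : Type*} (δ s : E → ℝ) (w : Fin 4 → E) : ℝ :=
  ∑ p, ∑ q, if p ≠ q then δ (w p) * s (w q) else 0

lemma crossSum_perm {E : Type*} (δ s : E → ℝ) (w : Fin 4 → E) (σ : Equiv.Perm (Fin 4)) :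
    crossSum δ s (fun i => w (σ i)) = crossSum δ s w := by
  unfold crossSum
  rw [← Equiv.sum_comp σ (fun p => ∑ q, if p ≠ q then δ (w p) * s (w q) else 0)]
  refine Finset.sum_congr rfl fun p _ => ?_
  rw [← Equiv.sum_comp σ (fun q => if σ p ≠ q then δ (w (σ p)) * s (w q) else 0)]
  simp

lemma le_crossSum {E : Type*} {δ s : E → ℝ} (hδ : ∀ e, 0 ≤ δ e) (hs : ∀ e, 0 ≤ s e)
    (w : Fin 4 → E) {p q : Fin 4} (hpq : p ≠ q) : δ (w p) * s (w q) ≤ crossSum δ s w := by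
  have h0 : ∀ p q : Fin 4, 0 ≤ if p ≠ q then δ (w p) * s (w q) else 0 := fun p q => by
    split_ifs
    · exact mul_nonneg (hδ _) (hs _)
    · exact le_rfl
  calc δ (w p) * s (w q) = if p ≠ q then δ (w p) * s (w q) else 0 := by rw [if_pos hpq]
    _ ≤ ∑ q, if p ≠ q then δ (w p) * s (w q) else 0 :=
        Finset.single_le_sum (f := fun q => if p ≠ q then δ (w p) * s (w q) else 0)
          (fun q _ => h0 p q) (Finset.mem_univ q)
    _ ≤ crossSum δ s w :=
        Finset.single_le_sum (f := fun p => ∑ q, if p ≠ q then δ (w p) * s (w q) else 0)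
          (fun p _ => Finset.sum_nonneg fun q _ => h0 p q) (Finset.mem_univ p)

/-- The distance between the two components of a pair of points of the state space. -/
noncomputable def gap (w : PathPair × PathPair) : ℝ := ‖w.1 - w.2‖

/-- The total size of a pair of points of the state space. -/
noncomputable def size (w : PathPair × PathPair) : ℝ := ‖w.1‖ + ‖w.2‖

lemma gap_nonneg (w : PathPair × PathPair) : 0 ≤ gap w := norm_nonneg _

lemma size_nonneg (w : PathPair × PathPair) : 0 ≤ size w := by unfold size; positivity

/-- In AB - A'B' = (A - A')B + A'(B - B') a displacement at p multiplies a reduced distance, which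
is bounded through either of its endpoints. One of the two endpoints differs from p, so an
off-diagonal product always suffices. -/
lemma abs_reducedDist_mul_sub_le (w : Fin 4 → PathPair × PathPair) {a b c d : Fin 4}
    (hab : a ≠ b) (hcd : c ≠ d) :
    |reducedDist (w a).1.1 (w b).1.1 * reducedDist (w c).1.2 (w d).1.2
      - reducedDist (w a).2.1 (w b).2.1 * reducedDist (w c).2.2 (w d).2.2|
      ≤ 16 * crossSum gap size w := by
  set T := crossSum gap size w
  have key : ∀ {p q r : Fin 4} {u : ℝ}, q ≠ r → |u| ≤ 2 * size (w q) → |u| ≤ 2 * size (w r) →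
      gap (w p) * |u| ≤ 2 * T := by
    intro p q r u hqr hq hr
    by_cases h : p = q
    · have := le_crossSum gap_nonneg size_nonneg w (h ▸ hqr : p ≠ r)
      nlinarith [mul_le_mul_of_nonneg_left hr (gap_nonneg (w p))]
    · have := le_crossSum gap_nonneg size_nonneg w h
      nlinarith [mul_le_mul_of_nonneg_left hq (gap_nonneg (w p))]
  have hX : ∀ p : Fin 4, ‖(w p).1.1‖ ≤ size (w p) ∧ ‖(w p).2.1‖ ≤ size (w p) ∧
      ‖(w p).1.2‖ ≤ size (w p) ∧ ‖(w p).2.2‖ ≤ size (w p) ∧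
      ‖(w p).1.1 - (w p).2.1‖ ≤ gap (w p) ∧ ‖(w p).1.2 - (w p).2.2‖ ≤ gap (w p) := by
    intro p
    have h1 := norm_fst_le (w p).1
    have h2 := norm_fst_le (w p).2
    have h3 := norm_snd_le (w p).1
    have h4 := norm_snd_le (w p).2
    have h5 := norm_fst_le ((w p).1 - (w p).2)
    have h6 := norm_snd_le ((w p).1 - (w p).2)
    have h7 := norm_nonneg (w p).1
    have h8 := norm_nonneg (w p).2
    unfold size gap
    refine ⟨?_, ?_, ?_, ?_, h5, h6⟩ <;> linarith
  set A := reducedDist (w a).1.1 (w b).1.1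
  set A' := reducedDist (w a).2.1 (w b).2.1
  set B := reducedDist (w c).1.2 (w d).1.2
  set B' := reducedDist (w c).2.2 (w d).2.2
  have hA : |A - A'| ≤ 2 * (gap (w a) + gap (w b)) :=
    (abs_reducedDist_sub_le _ _ _ _).trans (by linarith [(hX a).2.2.2.2.1, (hX b).2.2.2.2.1])
  have hB : |B - B'| ≤ 2 * (gap (w c) + gap (w d)) :=
    (abs_reducedDist_sub_le _ _ _ _).trans (by linarith [(hX c).2.2.2.2.2, (hX d).2.2.2.2.2])
  have hBc : |B| ≤ 2 * size (w c) :=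
    (abs_reducedDist_le_left _ _).trans (by linarith [(hX c).2.2.1])
  have hBd : |B| ≤ 2 * size (w d) :=
    (abs_reducedDist_le_right _ _).trans (by linarith [(hX d).2.2.1])
  have hAa : |A'| ≤ 2 * size (w a) :=
    (abs_reducedDist_le_left _ _).trans (by linarith [(hX a).2.1])
  have hAb : |A'| ≤ 2 * size (w b) :=
    (abs_reducedDist_le_right _ _).trans (by linarith [(hX b).2.1])
  calc |A * B - A' * B'| = |(A - A') * B + A' * (B - B')| := by ring_nf
    _ ≤ |A - A'| * |B| + |A'| * |B - B'| := by
        rw [← abs_mul, ← abs_mul]; exact abs_add_le _ _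
    _ ≤ 2 * (gap (w a) + gap (w b)) * |B| + |A'| * (2 * (gap (w c) + gap (w d))) := by gcongr
    _ ≤ 16 * T := by
        nlinarith [key (p := a) hcd hBc hBd, key (p := b) hcd hBc hBd,
          key (p := c) hab hAa hAb, key (p := d) hab hAa hAb]

lemma abs_reducedKernel_sub_le (w : Fin 4 → PathPair × PathPair) :
    |reducedKernel (fun i => (w i).1) - reducedKernel (fun i => (w i).2)|
      ≤ 64 * crossSum gap size w := by
  have h1 := abs_reducedDist_mul_sub_le w (a := 0) (b := 1) (c := 0) (d := 1)
    (by decide) (by decide)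
  have h2 := abs_reducedDist_mul_sub_le w (a := 0) (b := 1) (c := 2) (d := 3)
    (by decide) (by decide)
  have h3 := abs_reducedDist_mul_sub_le w (a := 0) (b := 1) (c := 0) (d := 2)
    (by decide) (by decide)
  rw [abs_le] at h1 h2 h3
  unfold reducedKernel
  rw [abs_le]
  constructor <;> linarith

/-- The symmetrized kernel is Lipschitz with a constant that never pairs a variable with itself. -/
lemma abs_kernelH_sub_le (w : Fin 4 → PathPair × PathPair) :
    |kernelH (fun i => (w i).1) - kernelH (fun i => (w i).2)| ≤ 64 * crossSum gap size w := by
  rw [kernelH_eq, kernelH_eq, ← mul_sub, ← Finset.sum_sub_distrib, abs_mul]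
  calc |(1 / 24 : ℝ)| * |∑ σ : Equiv.Perm (Fin 4), (reducedKernel (fun i => (w (σ i)).1)
        - reducedKernel (fun i => (w (σ i)).2))|
      ≤ |(1 / 24 : ℝ)| * ∑ σ : Equiv.Perm (Fin 4), 64 * crossSum gap size w := by
        gcongr
        refine (Finset.abs_sum_le_sum_abs _ _).trans (Finset.sum_le_sum fun σ _ => ?_)
        rw [← crossSum_perm gap size w σ]
        exact abs_reducedKernel_sub_le fun i => w (σ i)
    _ = 64 * crossSum gap size w := by
        rw [Finset.sum_const, Finset.card_univ, Fintype.card_perm, Fintype.card_fin, nsmul_eq_mul,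
          abs_of_pos (by norm_num)]
        norm_num [Nat.factorial]
        ring

lemma continuous_kernelH : Continuous kernelH := by
  unfold kernelH kernelF
  fun_prop

/-! ### Degenerate projections of dominated kernels. -/

section Projection

variable {E : Type*} [MeasurableSpace E]

/-- The second-order degenerate projection of a kernel of four variables; `kernelH2 H` is the
projection of `kernelH`. -/
noncomputable def projTwo (π : Measure E) (k : (Fin 4 → E) → ℝ) (x y : E) : ℝ :=
  (∫ z, k ![x, y, z 0, z 1] ∂(iidLaw π 2))
    - (∫ z, k ![x, z 0, z 1, z 2] ∂(iidLaw π 3))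
    - (∫ z, k ![z 0, y, z 1, z 2] ∂(iidLaw π 3))
    + ∫ z, k z ∂(iidLaw π 4)

lemma kernelH2_eq_projTwo (H : Measure PathPair) (x y : PathPair) :
    kernelH2 H x y = projTwo H kernelH x y := rfl

lemma iidLaw_map {S : Type*} [MeasurableSpace S] (π : Measure E) [IsProbabilityMeasure π]
    {f : E → S} (hf : Measurable f) (n : ℕ) :
    iidLaw (π.map f) n = (iidLaw π n).map fun w i => f (w i) := by
  have := Measure.isProbabilityMeasure_map (μ := π) hf.aemeasurable
  exact (Measure.pi_map_pi (μ := fun _ : Fin n => π) (f := fun _ => f) fun _ => hf.aemeasurable).symm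

lemma integral_iidLaw_map {S : Type*} [MeasurableSpace S] {π : Measure E} [IsProbabilityMeasure π]
    {f : E → S} (hf : Measurable f) {n : ℕ} {φ : (Fin n → S) → ℝ} (hφ : Measurable φ) :
    ∫ z, φ z ∂(iidLaw (π.map f) n) = ∫ w, φ (fun i => f (w i)) ∂(iidLaw π n) := by
  rw [iidLaw_map π hf, integral_map _ hφ.aestronglyMeasurable]
  exact (measurable_pi_lambda _ fun i => hf.comp (measurable_pi_apply i)).aemeasurable

lemma measurable_vec4 {A : Type*} [MeasurableSpace A] {a b c d : A → E} (ha : Measurable a)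
    (hb : Measurable b) (hc : Measurable c) (hd : Measurable d) :
    Measurable fun t => (![a t, b t, c t, d t] : Fin 4 → E) := by
  refine measurable_pi_lambda _ fun i => ?_
  fin_cases i <;> assumption

/-- Applied to both coordinate maps of a coupling, this turns projections under two different laws
into projections under one law, which can be subtracted. -/
lemma projTwo_map {S : Type*} [MeasurableSpace S] {π : Measure E} [IsProbabilityMeasure π]
    {f : E → S} (hf : Measurable f) {k : (Fin 4 → S) → ℝ} (hk : Measurable k) (x y : E) :
    projTwo (π.map f) k (f x) (f y) = projTwo π (fun w => k fun i => f (w i)) x y := by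
  have hv : ∀ a b c d : E, (fun i => f ((![a, b, c, d] : Fin 4 → E) i))
      = ![f a, f b, f c, f d] := fun a b c d => by
    funext i; fin_cases i <;> rfl
  unfold projTwo
  simp only [hv]
  congr 1
  · congr 1
    · congr 1
      · exact integral_iidLaw_map hf (φ := fun z => k ![f x, f y, z 0, z 1])
          (hk.comp (measurable_vec4 (by fun_prop) (by fun_prop) (by fun_prop) (by fun_prop)))
      · exact integral_iidLaw_map hf (φ := fun z => k ![f x, z 0, z 1, z 2])
          (hk.comp (measurable_vec4 (by fun_prop) (by fun_prop) (by fun_prop) (by fun_prop)))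
    · exact integral_iidLaw_map hf (φ := fun z => k ![z 0, f y, z 1, z 2])
          (hk.comp (measurable_vec4 (by fun_prop) (by fun_prop) (by fun_prop) (by fun_prop)))
  · exact integral_iidLaw_map hf hk

/-- The product bound for projections of kernels dominated by `crossSum δ s`. -/
noncomputable def crossBound (π : Measure E) (δ s : E → ℝ) (x y : E) : ℝ :=
  (δ x + ∫ e, δ e ∂π) * (s y + ∫ e, s e ∂π) + (δ y + ∫ e, δ e ∂π) * (s x + ∫ e, s e ∂π)

/-- The kernel `k` of four variables is measurable and dominated by a multiple of
`crossSum δ s`, with integrable `δ` and `s`. -/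
structure CrossDominated (π : Measure E) (k : (Fin 4 → E) → ℝ) (δ s : E → ℝ) (C : ℝ) : Prop where
  measurable : Measurable k
  const_nonneg : 0 ≤ C
  left_nonneg : ∀ e, 0 ≤ δ e
  right_nonneg : ∀ e, 0 ≤ s e
  left_integrable : Integrable δ π
  right_integrable : Integrable s π
  bound : ∀ w, |k w| ≤ C * crossSum δ s w

/-- The point whose coordinates are taken from two given points and from a sample. -/
def mixPoint {A : Type*} {n : ℕ} (src : Fin 4 → Fin 2 ⊕ Fin n) (x y : A) (z : Fin n → A) :
    Fin 4 → A :=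
  fun p => Sum.elim ![x, y] z (src p)

lemma measurable_mixPoint {n : ℕ} (src : Fin 4 → Fin 2 ⊕ Fin n) :
    Measurable fun t : (E × E) × (Fin n → E) => mixPoint src t.1.1 t.1.2 t.2 := by
  refine measurable_pi_lambda _ fun p => ?_
  unfold mixPoint
  rcases src p with i | i
  · fin_cases i
    · exact measurable_fst.fst
    · exact measurable_fst.snd
  · exact (measurable_pi_apply i).comp measurable_snd

/-- The coordinates of `![x, y, z 0, z 1]`. -/
def srcTwo : Fin 4 → Fin 2 ⊕ Fin 2 := ![.inl 0, .inl 1, .inr 0, .inr 1]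
/-- The coordinates of `![x, z 0, z 1, z 2]`. -/
def srcLeft : Fin 4 → Fin 2 ⊕ Fin 3 := ![.inl 0, .inr 0, .inr 1, .inr 2]
/-- The coordinates of `![z 0, y, z 1, z 2]`. -/
def srcRight : Fin 4 → Fin 2 ⊕ Fin 3 := ![.inr 0, .inl 1, .inr 1, .inr 2]
/-- The coordinates of `![z 0, z 1, z 2, z 3]`. -/
def srcNone : Fin 4 → Fin 2 ⊕ Fin 4 := ![.inr 0, .inr 1, .inr 2, .inr 3]

lemma injective_src : Function.Injective srcTwo ∧ Function.Injective srcLeft ∧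
    Function.Injective srcRight ∧ Function.Injective srcNone := by
  refine ⟨?_, ?_, ?_, ?_⟩ <;> decide

lemma mixPoint_src {A : Type*} (x y : A) :
    (∀ z, mixPoint srcTwo x y z = ![x, y, z 0, z 1]) ∧
    (∀ z, mixPoint srcLeft x y z = ![x, z 0, z 1, z 2]) ∧
    (∀ z, mixPoint srcRight x y z = ![z 0, y, z 1, z 2]) ∧
    (∀ z, mixPoint srcNone x y z = z) := by
  refine ⟨?_, ?_, ?_, ?_⟩ <;> intro z <;> funext p <;> fin_cases p <;> rfl

lemma projTwo_eq_mixPoint (π : Measure E) (k : (Fin 4 → E) → ℝ) (x y : E) :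
    projTwo π k x y = (∫ z, k (mixPoint srcTwo x y z) ∂(iidLaw π 2))
      - (∫ z, k (mixPoint srcLeft x y z) ∂(iidLaw π 3))
      - (∫ z, k (mixPoint srcRight x y z) ∂(iidLaw π 3))
      + ∫ z, k (mixPoint srcNone x y z) ∂(iidLaw π 4) := by
  simp only [projTwo, mixPoint_src]

variable {π : Measure E} [IsProbabilityMeasure π]

/-- Since a ≠ b, the factors are fixed values or independent variables, so the integral factorizes
using first moments only. Each possible value is a term in the expansion of `crossBound`. -/
lemma integrable_and_integral_pair_le {δ s : E → ℝ} (hδ0 : ∀ e, 0 ≤ δ e) (hs0 : ∀ e, 0 ≤ s e)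
    (hδ : Integrable δ π) (hs : Integrable s π) {n : ℕ} (x y : E) {a b : Fin 2 ⊕ Fin n}
    (hab : a ≠ b) :
    Integrable (fun z => δ (Sum.elim ![x, y] z a) * s (Sum.elim ![x, y] z b)) (iidLaw π n) ∧
      ∫ z, δ (Sum.elim ![x, y] z a) * s (Sum.elim ![x, y] z b) ∂(iidLaw π n)
        ≤ crossBound π δ s x y := by
  have hδm : 0 ≤ ∫ e, δ e ∂π := integral_nonneg hδ0
  have hsm : 0 ≤ ∫ e, s e ∂π := integral_nonneg hs0
  have hev : ∀ i : Fin n, MeasurePreserving (Function.eval i) (iidLaw π n) π :=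
    fun i => measurePreserving_eval (fun _ => π) i
  have hint : ∀ (f : E → ℝ) (_ : Integrable f π) (i : Fin n),
      Integrable (fun z : Fin n → E => f (z i)) (iidLaw π n) ∧
        ∫ z, f (z i) ∂(iidLaw π n) = ∫ e, f e ∂π := by
    intro f hf i
    refine ⟨(hev i).integrable_comp_of_integrable hf, ?_⟩
    have h := integral_map (μ := iidLaw π n) (f := f) (hev i).aemeasurable
      (by rw [(hev i).map_eq]; exact hf.aestronglyMeasurable)
    rw [(hev i).map_eq] at h
    exact h.symm
  have p1 := mul_nonneg (hδ0 x) (hs0 y)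
  have p2 := mul_nonneg (hδ0 y) (hs0 x)
  have p3 := mul_nonneg (hδ0 x) hsm
  have p4 := mul_nonneg (hδ0 y) hsm
  have p5 := mul_nonneg hδm (hs0 x)
  have p6 := mul_nonneg hδm (hs0 y)
  have p7 := mul_nonneg hδm hsm
  unfold crossBound
  rcases a with i | i <;> rcases b with j | j
  · refine ⟨by simp only [Sum.elim_inl]; exact integrable_const _, ?_⟩
    simp only [Sum.elim_inl, integral_const, probReal_univ, one_smul]
    fin_cases i <;> fin_cases j <;> simp at hab ⊢ <;> nlinarith
  · simp only [Sum.elim_inl, Sum.elim_inr]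
    refine ⟨(hint s hs j).1.const_mul _, ?_⟩
    rw [integral_const_mul, (hint s hs j).2]
    fin_cases i <;> simp <;> nlinarith
  · simp only [Sum.elim_inl, Sum.elim_inr]
    refine ⟨(hint δ hδ i).1.mul_const _, ?_⟩
    rw [integral_mul_const, (hint δ hδ i).2]
    fin_cases j <;> simp <;> nlinarith
  · simp only [Sum.elim_inr]
    have hij : i ≠ j := fun h => hab (by rw [h])
    have hind : IndepFun (fun z : Fin n → E => δ (z i)) (fun z => s (z j)) (iidLaw π n) := by
      have h := (iIndepFun_pi (μ := fun _ : Fin n => π) (X := fun _ e => e)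
        fun _ => aemeasurable_id).indepFun hij
      -- The functions are only almost everywhere measurable; independence is transferred from their
      -- measurable versions.
      refine IndepFun.congr (f := fun z : Fin n → E => hδ.1.mk δ (z i))
        (g := fun z : Fin n → E => hs.1.mk s (z j))
        (h.comp hδ.1.stronglyMeasurable_mk.measurable hs.1.stronglyMeasurable_mk.measurable) ?_ ?_
      · exact ((hev i).quasiMeasurePreserving.ae_eq_comp hδ.1.ae_eq_mk).symm
      · exact ((hev j).quasiMeasurePreserving.ae_eq_comp hs.1.ae_eq_mk).symm
    refine ⟨hind.integrable_mul (hint δ hδ i).1 (hint s hs j).1, ?_⟩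
    have := hind.integral_fun_mul_eq_mul_integral (hint δ hδ i).1.1 (hint s hs j).1.1
    rw [this, (hint δ hδ i).2, (hint s hs j).2]
    nlinarith

lemma integrable_and_integral_crossSum_le {δ s : E → ℝ} (hδ0 : ∀ e, 0 ≤ δ e) (hs0 : ∀ e, 0 ≤ s e)
    (hδ : Integrable δ π) (hs : Integrable s π) {n : ℕ} {src : Fin 4 → Fin 2 ⊕ Fin n}
    (hsrc : Function.Injective src) (x y : E) :
    Integrable (fun z => crossSum δ s (mixPoint src x y z)) (iidLaw π n) ∧
      ∫ z, crossSum δ s (mixPoint src x y z) ∂(iidLaw π n) ≤ 16 * crossBound π δ s x y := by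
  have hB : 0 ≤ crossBound π δ s x y := by
    have hδm : 0 ≤ ∫ e, δ e ∂π := integral_nonneg hδ0
    have hsm : 0 ≤ ∫ e, s e ∂π := integral_nonneg hs0
    have := hδ0 x; have := hδ0 y; have := hs0 x; have := hs0 y
    unfold crossBound; positivity
  have h : ∀ p q : Fin 4,
      Integrable (fun z => if p ≠ q then δ (mixPoint src x y z p) * s (mixPoint src x y z q) else 0)
        (iidLaw π n) ∧
      ∫ z, (if p ≠ q then δ (mixPoint src x y z p) * s (mixPoint src x y z q) else 0) ∂(iidLaw π n)
        ≤ crossBound π δ s x y := by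
    intro p q
    by_cases hpq : p = q
    · simpa [hpq] using hB
    · simpa only [if_pos hpq, mixPoint, ne_eq, hpq, not_false_eq_true, if_true] using
        integrable_and_integral_pair_le hδ0 hs0 hδ hs x y (hsrc.ne hpq)
  unfold crossSum
  refine ⟨integrable_finsetSum _ fun p _ => integrable_finsetSum _ fun q _ => (h p q).1, ?_⟩
  rw [integral_finsetSum _ fun p _ => integrable_finsetSum _ fun q _ => (h p q).1]
  calc _ ≤ ∑ _p : Fin 4, ∑ _q : Fin 4, crossBound π δ s x y := by
        refine Finset.sum_le_sum fun p _ => ?_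
        rw [integral_finsetSum _ fun q _ => (h p q).1]
        exact Finset.sum_le_sum fun q _ => (h p q).2
    _ = 16 * crossBound π δ s x y := by simp; ring

namespace CrossDominated

variable {k : (Fin 4 → E) → ℝ} {δ s : E → ℝ} {C : ℝ}

lemma integrable_and_abs_integral_le (h : CrossDominated π k δ s C) {n : ℕ}
    {src : Fin 4 → Fin 2 ⊕ Fin n} (hsrc : Function.Injective src) (x y : E) :
    Integrable (fun z => k (mixPoint src x y z)) (iidLaw π n) ∧
      |∫ z, k (mixPoint src x y z) ∂(iidLaw π n)| ≤ C * (16 * crossBound π δ s x y) := by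
  obtain ⟨hi, hb⟩ := integrable_and_integral_crossSum_le h.left_nonneg h.right_nonneg
    h.left_integrable h.right_integrable hsrc x y
  have hm : Measurable fun z : Fin n → E => k (mixPoint src x y z) :=
    h.measurable.comp ((measurable_mixPoint src).comp
      (measurable_prodMk_left (x := (x, y))))
  have hle : ∀ z : Fin n → E, ‖k (mixPoint src x y z)‖ ≤ C * crossSum δ s (mixPoint src x y z) :=
    fun z => h.bound _
  refine ⟨(hi.const_mul C).mono' hm.aestronglyMeasurable (Eventually.of_forall hle), ?_⟩
  calc |∫ z, k (mixPoint src x y z) ∂(iidLaw π n)|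
      ≤ ∫ z, C * crossSum δ s (mixPoint src x y z) ∂(iidLaw π n) :=
        norm_integral_le_of_norm_le (hi.const_mul C) (Eventually.of_forall hle)
    _ = C * ∫ z, crossSum δ s (mixPoint src x y z) ∂(iidLaw π n) := integral_const_mul _ _
    _ ≤ _ := mul_le_mul_of_nonneg_left hb h.const_nonneg

end CrossDominated

lemma measurable_projTwo {k : (Fin 4 → E) → ℝ} (hk : Measurable k) :
    Measurable fun t : E × E => projTwo π k t.1 t.2 := by
  simp only [projTwo_eq_mixPoint]
  have h : ∀ {n : ℕ} (src : Fin 4 → Fin 2 ⊕ Fin n),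
      Measurable fun t : E × E => ∫ z, k (mixPoint src t.1 t.2 z) ∂(iidLaw π n) := fun src =>
    ((hk.comp (measurable_mixPoint src)).stronglyMeasurable.integral_prod_right'
      (f := fun t : (E × E) × _ => k (mixPoint src t.1.1 t.1.2 t.2))).measurable
  exact (((h _).sub (h _)).sub (h _)).add (h _)

namespace CrossDominated

variable {k : (Fin 4 → E) → ℝ} {δ s : E → ℝ} {C : ℝ}

/-- Four integrals, each bounded by 16 C times `crossBound`. -/
lemma abs_projTwo_le (h : CrossDominated π k δ s C) (x y : E) :
    |projTwo π k x y| ≤ 64 * C * crossBound π δ s x y := by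
  obtain ⟨h1, h2, h3, h4⟩ := injective_src
  have b1 := (h.integrable_and_abs_integral_le h1 x y).2
  have b2 := (h.integrable_and_abs_integral_le h2 x y).2
  have b3 := (h.integrable_and_abs_integral_le h3 x y).2
  have b4 := (h.integrable_and_abs_integral_le h4 x y).2
  rw [projTwo_eq_mixPoint]
  rw [abs_le] at *
  constructor <;> linarith

lemma projTwo_sub (h : CrossDominated π k δ s C) {k' : (Fin 4 → E) → ℝ} {δ' s' : E → ℝ} {C' : ℝ}
    (h' : CrossDominated π k' δ' s' C') (x y : E) :
    projTwo π (fun w => k w - k' w) x y = projTwo π k x y - projTwo π k' x y := by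
  obtain ⟨h1, h2, h3, h4⟩ := injective_src
  simp only [projTwo_eq_mixPoint]
  rw [integral_sub (h.integrable_and_abs_integral_le h1 x y).1
      (h'.integrable_and_abs_integral_le h1 x y).1,
    integral_sub (h.integrable_and_abs_integral_le h2 x y).1
      (h'.integrable_and_abs_integral_le h2 x y).1,
    integral_sub (h.integrable_and_abs_integral_le h3 x y).1
      (h'.integrable_and_abs_integral_le h3 x y).1,
    integral_sub (h.integrable_and_abs_integral_le h4 x y).1
      (h'.integrable_and_abs_integral_le h4 x y).1]
  ring

end CrossDominated

lemma integral_insertNth {n : ℕ} (i : Fin (n + 1)) {φ : (Fin (n + 1) → E) → ℝ}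
    (hφ : Integrable φ (iidLaw π (n + 1))) :
    Integrable (fun y => ∫ z, φ (i.insertNth y z) ∂(iidLaw π n)) π ∧
      ∫ y, ∫ z, φ (i.insertNth y z) ∂(iidLaw π n) ∂π = ∫ w, φ w ∂(iidLaw π (n + 1)) := by
  have hmp := (measurePreserving_piFinSuccAbove (fun _ : Fin (n + 1) => π) i).symm
  have hi := hmp.integrable_comp_of_integrable hφ
  refine ⟨hi.integral_prod_left, ?_⟩
  rw [← hmp.integral_comp (MeasurableEquiv.measurableEmbedding _)]
  exact (integral_prod _ hi).symm

namespace CrossDominated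

variable {k : (Fin 4 → E) → ℝ} {δ s : E → ℝ} {C : ℝ}

/-- Integrating y out turns the first term into the second and the third into the fourth, so they
cancel in pairs. No symmetry of k is needed. -/
lemma integral_projTwo_right (h : CrossDominated π k δ s C) (x : E) :
    ∫ y, projTwo π k x y ∂π = 0 := by
  obtain ⟨-, h2, -, h4⟩ := injective_src
  obtain ⟨-, e2, -, e4⟩ := mixPoint_src x x
  have i1 := (h.integrable_and_abs_integral_le h2 x x).1
  have i2 := (h.integrable_and_abs_integral_le h4 x x).1
  simp only [e2, e4] at i1 i2
  obtain ⟨j1, k1⟩ := integral_insertNth 0 i1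
  obtain ⟨j2, k2⟩ := integral_insertNth 1 i2
  have f1 : ∀ y (z : Fin 2 → E), (![x, (Fin.insertNth 0 y z : Fin 3 → E) 0,
      (Fin.insertNth 0 y z : Fin 3 → E) 1, (Fin.insertNth 0 y z : Fin 3 → E) 2] : Fin 4 → E)
      = ![x, y, z 0, z 1] := fun y z => by
    funext p; fin_cases p <;> rfl
  have f2 : ∀ y (z : Fin 3 → E), (Fin.insertNth 1 y z : Fin 4 → E) = ![z 0, y, z 1, z 2] :=
    fun y z => by funext p; fin_cases p <;> rfl
  simp only [f1] at j1 k1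
  simp only [f2] at j2 k2
  unfold projTwo
  rw [integral_add, integral_sub, integral_sub, k1, k2]
  · simp
  · exact j1
  · exact integrable_const _
  · exact j1.sub (integrable_const _)
  · exact j2
  · exact (j1.sub (integrable_const _)).sub j2
  · exact integrable_const _

lemma integral_projTwo_left (h : CrossDominated π k δ s C) (y : E) :
    ∫ x, projTwo π k x y ∂π = 0 := by
  obtain ⟨-, -, h3, h4⟩ := injective_src
  obtain ⟨-, -, e3, e4⟩ := mixPoint_src y y
  have i1 := (h.integrable_and_abs_integral_le h3 y y).1
  have i2 := (h.integrable_and_abs_integral_le h4 y y).1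
  simp only [e3, e4] at i1 i2
  obtain ⟨j1, k1⟩ := integral_insertNth 0 i1
  obtain ⟨j2, k2⟩ := integral_insertNth 0 i2
  have f1 : ∀ x (z : Fin 2 → E), (![(Fin.insertNth 0 x z : Fin 3 → E) 0, y,
      (Fin.insertNth 0 x z : Fin 3 → E) 1, (Fin.insertNth 0 x z : Fin 3 → E) 2] : Fin 4 → E)
      = ![x, y, z 0, z 1] := fun x z => by
    funext p; fin_cases p <;> rfl
  have f2 : ∀ x (z : Fin 3 → E), (Fin.insertNth 0 x z : Fin 4 → E) = ![x, z 0, z 1, z 2] :=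
    fun x z => by funext p; fin_cases p <;> rfl
  simp only [f1] at j1 k1
  simp only [f2] at j2 k2
  unfold projTwo
  rw [integral_add, integral_sub, integral_sub, k1, k2]
  · simp
  · exact j1
  · exact j2
  · exact j1.sub j2
  · exact integrable_const _
  · exact (j1.sub j2).sub (integrable_const _)
  · exact integrable_const _

end CrossDominated

end Projection

/-! ### Second moments of degenerate U-statistics. -/

section Degenerate

variable {E : Type*} [MeasurableSpace E] {π : Measure E} [IsProbabilityMeasure π]

lemma measurePreserving_pair {n : ℕ} {i j : Fin n} (hij : i ≠ j) :
    MeasurePreserving (fun w : Fin n → E => (w i, w j)) (iidLaw π n) (π.prod π) := by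
  refine ⟨by fun_prop, ?_⟩
  have h := (iIndepFun_pi (μ := fun _ : Fin n => π) (X := fun _ e => e)
    fun _ => aemeasurable_id).indepFun hij
  rw [indepFun_iff_map_prod_eq_prod_map_map (measurable_pi_apply i).aemeasurable
    (measurable_pi_apply j).aemeasurable] at h
  rw [h]
  exact congrArg₂ Measure.prod (measurePreserving_eval (fun _ => π) i).map_eq
    (measurePreserving_eval (fun _ => π) j).map_eq

lemma integral_insertNth_symm {n : ℕ} (i : Fin (n + 1)) {φ : (Fin (n + 1) → E) → ℝ}
    (hφ : Integrable φ (iidLaw π (n + 1))) :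
    ∫ z, ∫ y, φ (i.insertNth y z) ∂π ∂(iidLaw π n) = ∫ w, φ w ∂(iidLaw π (n + 1)) := by
  have hmp := (measurePreserving_piFinSuccAbove (fun _ : Fin (n + 1) => π) i).symm
  have hi := hmp.integrable_comp_of_integrable hφ
  rw [← hmp.integral_comp (MeasurableEquiv.measurableEmbedding _)]
  exact (integral_prod_symm _ hi).symm

/-- The index i occurs only in the first slot of φ, so integrating the i-th coordinate first
annihilates the product. -/
lemma integral_pair_mul_pair_eq_zero {φ ψ : E × E → ℝ} (hφ : MemLp φ 2 (π.prod π))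
    (hψ : MemLp ψ 2 (π.prod π)) (h0 : ∀ y, ∫ x, φ (x, y) ∂π = 0) {n : ℕ} {i j k l : Fin n}
    (hij : i ≠ j) (hik : i ≠ k) (hil : i ≠ l) (hkl : k ≠ l) :
    ∫ w, φ (w i, w j) * ψ (w k, w l) ∂(iidLaw π n) = 0 := by
  obtain ⟨m, rfl⟩ : ∃ m, n = m + 1 := ⟨n - 1, by have := i.pos; omega⟩
  have hint : Integrable (fun w : Fin (m + 1) → E => φ (w i, w j) * ψ (w k, w l))
      (iidLaw π (m + 1)) :=
    (hφ.comp_measurePreserving (measurePreserving_pair hij)).integrable_mul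
      (hψ.comp_measurePreserving (measurePreserving_pair hkl))
  rw [← integral_insertNth_symm i hint]
  obtain ⟨j', rfl⟩ := Fin.exists_succAbove_eq hij.symm
  obtain ⟨k', rfl⟩ := Fin.exists_succAbove_eq hik.symm
  obtain ⟨l', rfl⟩ := Fin.exists_succAbove_eq hil.symm
  simp only [Fin.insertNth_apply_same, Fin.insertNth_apply_succAbove, integral_mul_const, h0,
    zero_mul, integral_zero]

/-- The second moment of an unnormalized degenerate `U`-statistic of order two. -/
lemma integral_sum_offDiag_sq_le {g : E × E → ℝ} (hg : MemLp g 2 (π.prod π))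
    (h1 : ∀ y, ∫ x, g (x, y) ∂π = 0) (h2 : ∀ x, ∫ y, g (x, y) ∂π = 0) (n : ℕ) :
    Integrable (fun w => (∑ ij ∈ (Finset.univ : Finset (Fin n)).offDiag, g (w ij.1, w ij.2)) ^ 2)
        (iidLaw π n) ∧
      ∫ w, (∑ ij ∈ (Finset.univ : Finset (Fin n)).offDiag, g (w ij.1, w ij.2)) ^ 2 ∂(iidLaw π n)
        ≤ 2 * (n : ℝ) ^ 2 * ∫ t, g t ^ 2 ∂(π.prod π) := by
  set D := (Finset.univ : Finset (Fin n)).offDiag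
  set M := ∫ t, g t ^ 2 ∂(π.prod π)
  have hM : 0 ≤ M := integral_nonneg fun _ => sq_nonneg _
  have hne : ∀ p ∈ D, p.1 ≠ p.2 := fun p hp => (Finset.mem_offDiag.1 hp).2.2
  have hL : ∀ p ∈ D, MemLp (fun w : Fin n → E => g (w p.1, w p.2)) 2 (iidLaw π n) :=
    fun p hp => hg.comp_measurePreserving (measurePreserving_pair (hne p hp))
  have hsq : ∀ p ∈ D, ∫ w, g (w p.1, w p.2) ^ 2 ∂(iidLaw π n) = M := fun p hp => by
    have hmp := measurePreserving_pair (π := π) (hne p hp)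
    have h := integral_map (μ := iidLaw π n) (f := fun t => g t ^ 2) hmp.aemeasurable
      (by rw [hmp.map_eq]; exact hg.aestronglyMeasurable.pow 2)
    rw [hmp.map_eq] at h
    exact h.symm
  have hI : ∀ p ∈ D, ∀ q ∈ D,
      Integrable (fun w : Fin n → E => g (w p.1, w p.2) * g (w q.1, w q.2)) (iidLaw π n) :=
    fun p hp q hq => (hL p hp).integrable_mul (hL q hq)
  have hswap : MemLp (fun t : E × E => g t.swap) 2 (π.prod π) :=
    hg.comp_measurePreserving Measure.measurePreserving_swap
  -- If q is neither p nor its swap, some index of p is missing from q and degeneracy gives zero.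
  -- The two remaining q contribute at most M each, whence the factor 2.
  have hpq : ∀ p ∈ D, ∀ q ∈ D, ∫ w, g (w p.1, w p.2) * g (w q.1, w q.2) ∂(iidLaw π n)
      ≤ if q ∈ ({p, p.swap} : Finset (Fin n × Fin n)) then M else 0 := by
    intro p hp q hq
    split_ifs with h
    · calc ∫ w, g (w p.1, w p.2) * g (w q.1, w q.2) ∂(iidLaw π n)
          ≤ ∫ w, (1 / 2 * g (w p.1, w p.2) ^ 2 + 1 / 2 * g (w q.1, w q.2) ^ 2) ∂(iidLaw π n) := by
            refine integral_mono (hI p hp q hq) (((hL p hp).integrable_sq.const_mul _).add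
              ((hL q hq).integrable_sq.const_mul _)) fun w => ?_
            beta_reduce
            nlinarith [sq_nonneg (g (w p.1, w p.2) - g (w q.1, w q.2))]
        _ = M := by
            rw [integral_add ((hL p hp).integrable_sq.const_mul _)
              ((hL q hq).integrable_sq.const_mul _), integral_const_mul, integral_const_mul,
              hsq p hp, hsq q hq]
            ring
    · refine le_of_eq ?_
      obtain ⟨i, j⟩ := p
      obtain ⟨k, l⟩ := q
      have hij : i ≠ j := hne _ hp
      have hkl : k ≠ l := hne _ hq
      simp only [Finset.mem_insert, Finset.mem_singleton, Prod.swap_prod_mk, Prod.mk.injEq,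
        not_or, not_and] at h
      by_cases hi : i ≠ k ∧ i ≠ l
      · exact integral_pair_mul_pair_eq_zero hg hg h1 hij hi.1 hi.2 hkl
      · have hj : j ≠ k ∧ j ≠ l := by
          refine ⟨?_, ?_⟩
          · rintro rfl
            rcases eq_or_ne i l with rfl | hl
            · exact h.2 rfl rfl
            · exact hi ⟨hij, hl⟩
          · rintro rfl
            rcases eq_or_ne i k with rfl | hk
            · exact h.1 rfl rfl
            · exact hi ⟨hk, hij⟩
        exact integral_pair_mul_pair_eq_zero hswap hg h2 hij.symm hj.1 hj.2 hkl
  have hexp : ∀ w : Fin n → E, (∑ p ∈ D, g (w p.1, w p.2)) ^ 2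
      = ∑ p ∈ D, ∑ q ∈ D, g (w p.1, w p.2) * g (w q.1, w q.2) := fun w => by
    rw [sq, Finset.sum_mul_sum]
  simp only [hexp]
  refine ⟨integrable_finsetSum _ fun p hp => integrable_finsetSum _ fun q hq => hI p hp q hq, ?_⟩
  rw [integral_finsetSum _ fun p hp => integrable_finsetSum _ fun q hq => hI p hp q hq]
  calc ∑ p ∈ D, ∫ w, ∑ q ∈ D, g (w p.1, w p.2) * g (w q.1, w q.2) ∂(iidLaw π n)
      ≤ ∑ _p ∈ D, 2 * M := by
        refine Finset.sum_le_sum fun p hp => ?_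
        rw [integral_finsetSum _ fun q hq => hI p hp q hq]
        refine (Finset.sum_le_sum fun q hq => hpq p hp q hq).trans ?_
        rw [← Finset.sum_filter, Finset.sum_const, nsmul_eq_mul]
        refine mul_le_mul_of_nonneg_right ?_ hM
        have : (D.filter fun q => q ∈ ({p, p.swap} : Finset (Fin n × Fin n))).card ≤ 2 :=
          (Finset.card_le_card fun q hq => (Finset.mem_filter.1 hq).2).trans Finset.card_le_two
        exact_mod_cast this
    _ ≤ 2 * (n : ℝ) ^ 2 * M := by
        rw [Finset.sum_const, nsmul_eq_mul]
        have : D.card ≤ n ^ 2 := by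
          rw [Finset.offDiag_card, Finset.card_univ, Fintype.card_fin, sq]
          exact Nat.sub_le _ _
        have : (D.card : ℝ) ≤ (n : ℝ) ^ 2 := by exact_mod_cast this
        nlinarith

lemma sq_integral_le {f : E → ℝ} (hf : MemLp f 2 π) : (∫ e, f e ∂π) ^ 2 ≤ ∫ e, f e ^ 2 ∂π := by
  have h := variance_nonneg f π
  rw [variance_eq_sub hf] at h
  simpa using h

lemma integral_add_mean_sq_le {f : E → ℝ} (hf : MemLp f 2 π) :
    Integrable (fun x => (f x + ∫ e, f e ∂π) ^ 2) π ∧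
      ∫ x, (f x + ∫ e, f e ∂π) ^ 2 ∂π ≤ 4 * ∫ e, f e ^ 2 ∂π := by
  have hi := (hf.add (memLp_const (∫ e, f e ∂π))).integrable_sq
  refine ⟨hi, ?_⟩
  calc ∫ x, (f x + ∫ e, f e ∂π) ^ 2 ∂π
      ≤ ∫ x, (2 * f x ^ 2 + 2 * (∫ e, f e ∂π) ^ 2) ∂π := by
        refine integral_mono hi ((hf.integrable_sq.const_mul 2).add (integrable_const _))
          fun x => ?_
        beta_reduce
        nlinarith [sq_nonneg (f x - ∫ e, f e ∂π)]
    _ = 2 * ∫ e, f e ^ 2 ∂π + 2 * (∫ e, f e ∂π) ^ 2 := by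
        rw [integral_add (hf.integrable_sq.const_mul 2) (integrable_const _), integral_const_mul]
        simp
    _ ≤ _ := by linarith [sq_integral_le hf]

lemma integral_crossBound_sq_le {δ s : E → ℝ} (hδ : MemLp δ 2 π) (hs : MemLp s 2 π) :
    Integrable (fun t : E × E => crossBound π δ s t.1 t.2 ^ 2) (π.prod π) ∧
      ∫ t, crossBound π δ s t.1 t.2 ^ 2 ∂(π.prod π)
        ≤ 64 * (∫ e, δ e ^ 2 ∂π) * ∫ e, s e ^ 2 ∂π := by
  obtain ⟨i1, b1⟩ := integral_add_mean_sq_le hδ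
  obtain ⟨i2, b2⟩ := integral_add_mean_sq_le hs
  have hδ0 : 0 ≤ ∫ e, δ e ^ 2 ∂π := integral_nonneg fun _ => sq_nonneg _
  have hs0 : 0 ≤ ∫ e, s e ^ 2 ∂π := integral_nonneg fun _ => sq_nonneg _
  set a := fun x => (δ x + ∫ e, δ e ∂π) ^ 2
  set b := fun x => (s x + ∫ e, s e ∂π) ^ 2
  -- From (u + v)² ≤ 2u² + 2v². Adding a mean costs a factor 4 in each second moment, so the total
  -- is (2 + 2)·4·4 = 64.
  have hdom : ∀ t : E × E, crossBound π δ s t.1 t.2 ^ 2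
      ≤ 2 * (a t.1 * b t.2) + 2 * (b t.1 * a t.2) := fun t => by
    simp only [crossBound, a, b]
    nlinarith [sq_nonneg ((δ t.1 + ∫ e, δ e ∂π) * (s t.2 + ∫ e, s e ∂π)
      - (δ t.2 + ∫ e, δ e ∂π) * (s t.1 + ∫ e, s e ∂π))]
  have hi : Integrable (fun t : E × E => 2 * (a t.1 * b t.2) + 2 * (b t.1 * a t.2)) (π.prod π) :=
    ((i1.mul_prod i2).const_mul 2).add ((i2.mul_prod i1).const_mul 2)
  have hm : AEStronglyMeasurable (fun t : E × E => crossBound π δ s t.1 t.2 ^ 2) (π.prod π) := by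
    have h1 := hδ.aestronglyMeasurable
    have h2 := hs.aestronglyMeasurable
    unfold crossBound
    exact (((h1.comp_fst.add_const _).mul (h2.comp_snd.add_const _)).add
      ((h1.comp_snd.add_const _).mul (h2.comp_fst.add_const _))).pow 2
  have hint := hi.mono' hm (Eventually.of_forall fun t => by
    rw [Real.norm_eq_abs, abs_of_nonneg (sq_nonneg _)]; exact hdom t)
  refine ⟨hint, (integral_mono hint hi hdom).trans ?_⟩
  rw [integral_add ((i1.mul_prod i2).const_mul 2) ((i2.mul_prod i1).const_mul 2),
    integral_const_mul, integral_const_mul, integral_prod_mul, integral_prod_mul]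
  have ha : 0 ≤ ∫ x, a x ∂π := integral_nonneg fun _ => sq_nonneg _
  have hb : 0 ≤ ∫ x, b x ∂π := integral_nonneg fun _ => sq_nonneg _
  have := mul_le_mul b1 b2 hb (by positivity)
  linarith

end Degenerate

/-! ### From a coupling of laws to a coupling of U-statistics. -/

lemma abs_kernelH_le (z : Fin 4 → PathPair) :
    |kernelH z| ≤ 64 * crossSum (fun e => ‖e‖) (fun e => ‖e‖) z := by
  have h := abs_kernelH_sub_le fun i => (z i, 0)
  have h0 : kernelH (fun _ => (0 : PathPair)) = 0 := by simp [kernelH, kernelF]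
  simp only [h0, sub_zero] at h
  simpa [crossSum, gap, size] using h

section Coupling

lemma crossDominated_kernelH {E : Type*} [MeasurableSpace E] {π : Measure E} {f : E → PathPair}
    (hf : Measurable f) (hi : Integrable (fun e => ‖f e‖) π) :
    CrossDominated π (fun w => kernelH fun i => f (w i)) (fun e => ‖f e‖) (fun e => ‖f e‖) 64 where
  measurable := continuous_kernelH.measurable.comp
    (measurable_pi_lambda _ fun i => hf.comp (measurable_pi_apply i))
  const_nonneg := by norm_num
  left_nonneg _ := norm_nonneg _
  right_nonneg _ := norm_nonneg _
  left_integrable := hi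
  right_integrable := hi
  bound w := abs_kernelH_le fun i => f (w i)

lemma crossDominated_kernelH_sub {π : Measure (PathPair × PathPair)}
    (h1 : Integrable (fun w => ‖w.1‖) π)
    (h2 : Integrable (fun w => ‖w.2‖) π) :
    CrossDominated π (fun w => kernelH (fun i => (w i).1) - kernelH (fun i => (w i).2))
      gap size 64 where
  measurable := (crossDominated_kernelH measurable_fst h1).measurable.sub
    (crossDominated_kernelH measurable_snd h2).measurable
  const_nonneg := by norm_num
  left_nonneg := gap_nonneg
  right_nonneg := size_nonneg
  left_integrable := by
    refine (h1.add h2).mono' ?_ (Eventually.of_forall fun w => ?_)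
    · exact (measurable_fst.sub measurable_snd).norm.aestronglyMeasurable
    · rw [Real.norm_eq_abs, abs_of_nonneg (gap_nonneg w)]
      exact norm_sub_le _ _
  right_integrable := h1.add h2
  bound := abs_kernelH_sub_le

lemma measurable_uStat {H : Measure PathPair} [IsProbabilityMeasure H] (n : ℕ) :
    Measurable (uStat H n) := by
  unfold uStat
  refine Measurable.const_mul (Finset.measurable_sum _ fun ij _ => ?_) _
  exact (measurable_projTwo continuous_kernelH.measurable).comp
    (f := fun z : Fin n → PathPair => (z ij.1, z ij.2)) (by fun_prop)

/-- The Mallows distance between the laws of two degenerate `U`-statistics is controlled by the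
second moments of a coupling of the underlying laws. -/
lemma mallows_uStat_le {π : Measure (PathPair × PathPair)} [IsProbabilityMeasure π]
    (h1 : MemLp (fun w : PathPair × PathPair => w.1) 2 π)
    (h2 : MemLp (fun w : PathPair × PathPair => w.2) 2 π) {n : ℕ} (hn : n ≠ 0) :
    mallows ((iidLaw (π.map Prod.fst) n).map (uStat (π.map Prod.fst) n))
        ((iidLaw (π.map Prod.snd) n).map (uStat (π.map Prod.snd) n))
      ≤ ENNReal.ofReal (2 * (64 ^ 5 * (∫ w, gap w ^ 2 ∂π) * ∫ w, size w ^ 2 ∂π)) ^ (1 / 2 : ℝ) := by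
  set F := π.map Prod.fst with hF
  set G := π.map Prod.snd with hG
  have : IsProbabilityMeasure F := Measure.isProbabilityMeasure_map measurable_fst.aemeasurable
  have : IsProbabilityMeasure G := Measure.isProbabilityMeasure_map measurable_snd.aemeasurable
  have i1 := (h1.integrable one_le_two).norm
  have i2 := (h2.integrable one_le_two).norm
  have hdF := crossDominated_kernelH (π := π) measurable_fst i1
  have hdG := crossDominated_kernelH (π := π) measurable_snd i2
  have hd := crossDominated_kernelH_sub i1 i2
  set g : (PathPair × PathPair) × (PathPair × PathPair) → ℝ := fun t =>
    projTwo π (fun w => kernelH (fun i => (w i).1) - kernelH (fun i => (w i).2)) t.1 t.2 with hgdef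
  have hgeq : ∀ x y, g (x, y) = kernelH2 F x.1 y.1 - kernelH2 G x.2 y.2 := fun x y => by
    rw [kernelH2_eq_projTwo, kernelH2_eq_projTwo, hF, hG,
      projTwo_map measurable_fst continuous_kernelH.measurable,
      projTwo_map measurable_snd continuous_kernelH.measurable]
    exact hdF.projTwo_sub hdG x y
  have hgap : MemLp gap 2 π := (h1.sub h2).norm
  have hsize : MemLp size 2 π := h1.norm.add h2.norm
  obtain ⟨ci, cb⟩ := integral_crossBound_sq_le hgap hsize
  have hgm : Measurable g := measurable_projTwo hd.measurable
  -- The factor is (64·64)²: one 64 from the projection, one from the Lipschitz bound. A fifth 64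
  -- comes from the second moment of `crossBound`.
  have hgle : ∀ t, g t ^ 2 ≤ 64 ^ 4 * crossBound π gap size t.1 t.2 ^ 2 := fun t => by
    have h := hd.abs_projTwo_le t.1 t.2
    have h' := pow_le_pow_left₀ (abs_nonneg _) h 2
    rw [sq_abs] at h'
    refine h'.trans (le_of_eq (by ring))
  have hgi : Integrable (fun t => g t ^ 2) (π.prod π) :=
    (ci.const_mul (64 ^ 4)).mono' (hgm.pow_const 2).aestronglyMeasurable
      (Eventually.of_forall fun t => by
        rw [Real.norm_eq_abs, abs_of_nonneg (sq_nonneg _)]; exact hgle t)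
  have hgL : MemLp g 2 (π.prod π) := (memLp_two_iff_integrable_sq hgm.aestronglyMeasurable).2 hgi
  have hM : ∫ t, g t ^ 2 ∂(π.prod π) ≤ 64 ^ 5 * (∫ w, gap w ^ 2 ∂π) * ∫ w, size w ^ 2 ∂π := by
    refine (integral_mono hgi (ci.const_mul (64 ^ 4)) hgle).trans ?_
    rw [integral_const_mul]
    linarith
  obtain ⟨si, sb⟩ := integral_sum_offDiag_sq_le hgL hd.integral_projTwo_left
    hd.integral_projTwo_right n
  -- Both statistics are evaluated on the same i.i.d. sample of pairs; the law of A is the coupling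
  -- used.
  set A : (Fin n → PathPair × PathPair) → ℝ × ℝ := fun w =>
    (uStat F n fun i => (w i).1, uStat G n fun i => (w i).2) with hA
  have m1 : Measurable fun w : Fin n → PathPair × PathPair => fun i => (w i).1 :=
    measurable_pi_lambda _ fun i => (measurable_pi_apply i).fst
  have m2 : Measurable fun w : Fin n → PathPair × PathPair => fun i => (w i).2 :=
    measurable_pi_lambda _ fun i => (measurable_pi_apply i).snd
  have hAm : Measurable A := ((measurable_uStat n).comp m1).prodMk ((measurable_uStat n).comp m2)
  have marg1 : ((iidLaw π n).map A).map Prod.fst = (iidLaw F n).map (uStat F n) := by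
    rw [Measure.map_map measurable_fst hAm, iidLaw_map π measurable_fst,
      Measure.map_map (measurable_uStat n) m1]
    rfl
  have marg2 : ((iidLaw π n).map A).map Prod.snd = (iidLaw G n).map (uStat G n) := by
    rw [Measure.map_map measurable_snd hAm, iidLaw_map π measurable_snd,
      Measure.map_map (measurable_uStat n) m2]
    rfl
  refine (iInf₂_le ((iidLaw π n).map A) ⟨marg1, marg2⟩).trans ?_
  gcongr
  rw [lintegral_map (by fun_prop) hAm]
  have hval : ∀ w, |(A w).1 - (A w).2| ^ 2 = ((n : ℝ)⁻¹) ^ 2 *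
      (∑ ij ∈ (Finset.univ : Finset (Fin n)).offDiag, g (w ij.1, w ij.2)) ^ 2 := fun w => by
    simp only [hA, uStat, hgeq, sq_abs, ← mul_sub, ← Finset.sum_sub_distrib, mul_pow]
  simp only [hval]
  rw [← ofReal_integral_eq_lintegral_ofReal (si.const_mul _)
    (Eventually.of_forall fun w => by positivity), integral_const_mul]
  refine ENNReal.ofReal_le_ofReal ?_
  have hn' : (n : ℝ) ≠ 0 := by exact_mod_cast hn
  calc ((n : ℝ)⁻¹) ^ 2 * ∫ w, (∑ ij ∈ (Finset.univ : Finset (Fin n)).offDiag,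
        g (w ij.1, w ij.2)) ^ 2 ∂(iidLaw π n)
      ≤ ((n : ℝ)⁻¹) ^ 2 * (2 * (n : ℝ) ^ 2 * ∫ t, g t ^ 2 ∂(π.prod π)) := by gcongr
    _ = 2 * ∫ t, g t ^ 2 ∂(π.prod π) := by field_simp
    _ ≤ _ := by linarith

end Coupling

/-! ### Maximal coupling of finite-valued functions. -/

section Maximal

variable {α β κ : Type*} [MeasurableSpace α] [MeasurableSpace β]

/-- The product of two finite measures of the same mass, scaled to have them as marginals. -/
noncomputable def scaledProd (μ : Measure α) (ν : Measure β) : Measure (α × β) :=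
  (μ Set.univ)⁻¹ • μ.prod ν

lemma scaledProd_marginals {μ : Measure α} {ν : Measure β} [IsFiniteMeasure μ] [IsFiniteMeasure ν]
    (h : μ Set.univ = ν Set.univ) :
    (scaledProd μ ν).map Prod.fst = μ ∧ (scaledProd μ ν).map Prod.snd = ν := by
  unfold scaledProd
  by_cases h0 : μ Set.univ = 0
  · have hμ := Measure.measure_univ_eq_zero.1 h0
    have hν := Measure.measure_univ_eq_zero.1 (h ▸ h0)
    simp [hμ, hν]
  · have hc : (μ Set.univ)⁻¹ * μ Set.univ = 1 := ENNReal.inv_mul_cancel h0 (measure_ne_top _ _)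
    rw [Measure.map_smul, Measure.map_smul, Measure.map_fst_prod, Measure.map_snd_prod, ← h,
      smul_smul, smul_smul, hc, one_smul, one_smul]
    exact ⟨rfl, rfl⟩

lemma scaledProd_univ {μ : Measure α} {ν : Measure β} [IsFiniteMeasure μ] [IsFiniteMeasure ν]
    (h : μ Set.univ = ν Set.univ) : scaledProd μ ν Set.univ = μ Set.univ := by
  have := (scaledProd_marginals h).1
  conv_rhs => rw [← this, Measure.map_apply measurable_fst MeasurableSet.univ]
  rfl

variable [Fintype κ] [MeasurableSpace κ] [MeasurableSingletonClass κ]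

lemma sum_restrict_fiber (μ : Measure α) {T : α → κ} (hT : Measurable T) :
    ∑ k, μ.restrict (T ⁻¹' {k}) = μ := by
  ext s hs
  rw [Measure.finsetSum_apply]
  have h := sum_measure_preimage_singleton (μ := μ.restrict s) (f := T) Finset.univ
    fun k _ => hT (measurableSet_singleton k)
  rw [Finset.coe_univ, Set.preimage_univ, Measure.restrict_apply_univ] at h
  rw [← h]
  refine Finset.sum_congr rfl fun k _ => ?_
  rw [Measure.restrict_apply hs, Measure.restrict_apply (hT (measurableSet_singleton k)),
    Set.inter_comm]

/-- Two probability measures can be coupled so that two finite-valued functions disagree with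
probability at most the total variation distance of their laws. -/
lemma exists_coupling_fiber (F : Measure α) (G : Measure β) [IsProbabilityMeasure F]
    [IsProbabilityMeasure G] {T : α → κ} {T' : β → κ} (hT : Measurable T) (hT' : Measurable T') :
    ∃ π : Measure (α × β), π.map Prod.fst = F ∧ π.map Prod.snd = G ∧
      π {t | T t.1 ≠ T' t.2} ≤ ∑ k, (F (T ⁻¹' {k}) - G (T' ⁻¹' {k})) := by
  set f : κ → ℝ≥0∞ := fun k => F (T ⁻¹' {k})
  set g : κ → ℝ≥0∞ := fun k => G (T' ⁻¹' {k})
  -- The mass common to both laws on cell k. These parts are coupled within the cell, where the two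
  -- functions agree, and the remainders by a product measure.
  set m : κ → ℝ≥0∞ := fun k => min (f k) (g k)
  have hf : ∀ k, f k ≠ ∞ := fun k => measure_ne_top _ _
  have hg : ∀ k, g k ≠ ∞ := fun k => measure_ne_top _ _
  have hmf : ∀ k, (f k)⁻¹ * m k * f k = m k := fun k => by
    rcases eq_or_ne (f k) 0 with h | h
    · simp [m, h]
    · rw [mul_right_comm, ENNReal.inv_mul_cancel h (hf k), one_mul]
  have hmg : ∀ k, (g k)⁻¹ * m k * g k = m k := fun k => by
    rcases eq_or_ne (g k) 0 with h | h
    · simp [m, h]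
    · rw [mul_right_comm, ENNReal.inv_mul_cancel h (hg k), one_mul]
  have hle : ∀ a b : ℝ≥0∞, b ≤ a → a⁻¹ * b ≤ 1 := fun a b h => by
    rw [mul_comm, ← div_eq_mul_inv]; exact ENNReal.div_le_of_le_mul (by simpa using h)
  have hcf : ∀ k, (f k)⁻¹ * m k ≤ 1 := fun k => hle _ _ (min_le_left _ _)
  have hcg : ∀ k, (g k)⁻¹ * m k ≤ 1 := fun k => hle _ _ (min_le_right _ _)
  set Fk : κ → Measure α := fun k => ((f k)⁻¹ * m k) • F.restrict (T ⁻¹' {k})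
  set Gk : κ → Measure β := fun k => ((g k)⁻¹ * m k) • G.restrict (T' ⁻¹' {k})
  set Fr : Measure α := ∑ k, (1 - (f k)⁻¹ * m k) • F.restrict (T ⁻¹' {k})
  set Gr : Measure β := ∑ k, (1 - (g k)⁻¹ * m k) • G.restrict (T' ⁻¹' {k})
  have hFk1 : ∀ k, IsFiniteMeasure (Fk k) := fun k =>
    (F.restrict (T ⁻¹' {k})).smul_finite (ne_top_of_le_ne_top ENNReal.one_ne_top (hcf k))
  have hGk1 : ∀ k, IsFiniteMeasure (Gk k) := fun k =>
    (G.restrict (T' ⁻¹' {k})).smul_finite (ne_top_of_le_ne_top ENNReal.one_ne_top (hcg k))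
  have hFk : ∀ k, Fk k Set.univ = m k := fun k => by
    simp only [Fk, Measure.smul_apply, Measure.restrict_apply_univ, smul_eq_mul]
    exact hmf k
  have hGk : ∀ k, Gk k Set.univ = m k := fun k => by
    simp only [Gk, Measure.smul_apply, Measure.restrict_apply_univ, smul_eq_mul]
    exact hmg k
  have hFs : ∑ k, Fk k + Fr = F := by
    simp only [Fk, Fr]
    rw [← Finset.sum_add_distrib]
    simp only [← add_smul, add_tsub_cancel_of_le (hcf _), one_smul]
    exact sum_restrict_fiber F hT
  have hGs : ∑ k, Gk k + Gr = G := by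
    simp only [Gk, Gr]
    rw [← Finset.sum_add_distrib]
    simp only [← add_smul, add_tsub_cancel_of_le (hcg _), one_smul]
    exact sum_restrict_fiber G hT'
  have hFr1 : IsFiniteMeasure Fr := isFiniteMeasure_of_le F (by
    conv_rhs => rw [← hFs]
    exact Measure.le_add_left le_rfl)
  have hGr1 : IsFiniteMeasure Gr := isFiniteMeasure_of_le G (by
    conv_rhs => rw [← hGs]
    exact Measure.le_add_left le_rfl)
  -- Truncated subtraction makes this the sum of positive parts, that is, the total variation
  -- distance.
  have hFr : Fr Set.univ = ∑ k, (f k - g k) := by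
    simp only [Fr, Measure.finsetSum_apply, Measure.smul_apply, Measure.restrict_apply_univ,
      smul_eq_mul]
    refine Finset.sum_congr rfl fun k _ => ?_
    change (1 - (f k)⁻¹ * m k) * f k = _
    rw [ENNReal.sub_mul fun _ _ => hf k, one_mul, hmf k]
    exact tsub_min
  have hr : Fr Set.univ = Gr Set.univ := by
    have h1 := congrArg (fun ν => ν Set.univ) hFs
    have h2 := congrArg (fun ν => ν Set.univ) hGs
    simp only [Measure.add_apply, Measure.finsetSum_apply, hFk, hGk, measure_univ] at h1 h2
    have hm : ∑ k, m k ≠ ∞ := ENNReal.sum_ne_top.2 fun k _ =>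
      ne_top_of_le_ne_top (hf k) (min_le_left _ _)
    exact (ENNReal.add_right_inj hm).1 (h1.trans h2.symm)
  have hFG : ∀ k, Fk k Set.univ = Gk k Set.univ := fun k => (hFk k).trans (hGk k).symm
  refine ⟨∑ k, scaledProd (Fk k) (Gk k) + scaledProd Fr Gr, ?_, ?_, ?_⟩
  · rw [Measure.map_add _ _ measurable_fst, Measure.map_finset_sum measurable_fst.aemeasurable,
      (scaledProd_marginals hr).1]
    simp only [(scaledProd_marginals (hFG _)).1]
    exact hFs
  · rw [Measure.map_add _ _ measurable_snd, Measure.map_finset_sum measurable_snd.aemeasurable,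
      (scaledProd_marginals hr).2]
    simp only [(scaledProd_marginals (hFG _)).2]
    exact hGs
  · have hk0 : ∀ k, scaledProd (Fk k) (Gk k) {t | T t.1 ≠ T' t.2} = 0 := fun k => by
      have h1 : ∀ᵐ t ∂(scaledProd (Fk k) (Gk k)), T t.1 = k := by
        have hz : ∀ᵐ a ∂(Fk k), T a = k :=
          Measure.ae_smul_measure (ae_restrict_mem (hT (measurableSet_singleton k))) _
        rw [← (scaledProd_marginals (hFG k)).1] at hz
        exact ae_of_ae_map measurable_fst.aemeasurable hz
      have h2 : ∀ᵐ t ∂(scaledProd (Fk k) (Gk k)), T' t.2 = k := by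
        have hz : ∀ᵐ a ∂(Gk k), T' a = k :=
          Measure.ae_smul_measure (ae_restrict_mem (hT' (measurableSet_singleton k))) _
        rw [← (scaledProd_marginals (hFG k)).2] at hz
        exact ae_of_ae_map measurable_snd.aemeasurable hz
      have h3 : ∀ᵐ t ∂(scaledProd (Fk k) (Gk k)), T t.1 = T' t.2 := by
        filter_upwards [h1, h2] with t ht ht' using ht.trans ht'.symm
      exact h3
    rw [Measure.add_apply, Measure.finsetSum_apply]
    simp only [hk0, Finset.sum_const_zero, zero_add]
    exact (measure_mono (Set.subset_univ _)).trans_eq ((scaledProd_univ hr).trans hFr)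

end Maximal

/-! ### Couplings with empirical laws through quantization. -/

section Empirical

lemma lintegral_empiricalLaw {S : Type*} [MeasurableSpace S] {n : ℕ} (z : Fin n → S) {φ : S → ℝ≥0∞}
    (hφ : Measurable φ) : ∫⁻ s, φ s ∂(empiricalLaw z) = (n : ℝ≥0∞)⁻¹ * ∑ i, φ (z i) := by
  rw [empiricalLaw, lintegral_smul_measure, lintegral_finsetSum_measure]
  simp [lintegral_dirac' _ hφ]

lemma isProbabilityMeasure_empiricalLaw {S : Type*} [MeasurableSpace S] {n : ℕ} (hn : n ≠ 0)
    (z : Fin n → S) : IsProbabilityMeasure (empiricalLaw z) := by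
  refine ⟨?_⟩
  have h := lintegral_empiricalLaw z (φ := fun _ => 1) measurable_const
  simp only [lintegral_const, one_mul, Finset.sum_const, Finset.card_univ, Fintype.card_fin,
    nsmul_eq_mul, mul_one] at h
  rw [h]
  exact ENNReal.inv_mul_cancel (by exact_mod_cast hn) (ENNReal.natCast_ne_top n)

lemma empiricalLaw_map {S S' : Type*} [MeasurableSpace S] [MeasurableSpace S'] {n : ℕ}
    (z : Fin n → S) {f : S → S'} (hf : Measurable f) :
    (empiricalLaw z).map f = empiricalLaw fun i => f (z i) := by
  ext s hs
  rw [Measure.map_apply hf hs, ← lintegral_indicator_one (hf hs), ← lintegral_indicator_one hs,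
    lintegral_empiricalLaw z (measurable_one.indicator (hf hs)),
    lintegral_empiricalLaw _ (measurable_one.indicator hs)]
  rfl

variable {V : Type*} [NormedAddCommGroup V]

lemma enorm_sub_sq_le_four (a b c d e : V) :
    ‖a - e‖ₑ ^ 2 ≤ 4 * (‖a - b‖ₑ ^ 2 + ‖b - c‖ₑ ^ 2 + ‖c - d‖ₑ ^ 2 + ‖d - e‖ₑ ^ 2) := by
  have h : ‖a - e‖ ≤ ‖a - b‖ + ‖b - c‖ + ‖c - d‖ + ‖d - e‖ := by
    rw [show a - e = (a - b) + (b - c) + (c - d) + (d - e) by abel]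
    exact (norm_add_le _ _).trans (by gcongr; exact norm_add₃_le)
  have h2 : ‖a - e‖ ^ 2 ≤ 4 * (‖a - b‖ ^ 2 + ‖b - c‖ ^ 2 + ‖c - d‖ ^ 2 + ‖d - e‖ ^ 2) := by
    refine (pow_le_pow_left₀ (norm_nonneg _) h 2).trans ?_
    nlinarith [sq_nonneg (‖a - b‖ - ‖b - c‖), sq_nonneg (‖a - b‖ - ‖c - d‖),
      sq_nonneg (‖a - b‖ - ‖d - e‖), sq_nonneg (‖b - c‖ - ‖c - d‖),
      sq_nonneg (‖b - c‖ - ‖d - e‖), sq_nonneg (‖c - d‖ - ‖d - e‖)]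
  have h3 := ENNReal.ofReal_le_ofReal h2
  rw [ENNReal.ofReal_mul (by norm_num), ENNReal.ofReal_add (by positivity) (by positivity),
    ENNReal.ofReal_add (by positivity) (by positivity),
    ENNReal.ofReal_add (by positivity) (by positivity)] at h3
  simpa [ENNReal.ofReal_pow, ofReal_norm] using h3

variable [MeasurableSpace V] [BorelSpace V] [SecondCountableTopology V]

/-- A coupling of a law with the empirical law of perturbed points, with a quadratic cost
controlled through a quantization `T`. -/
lemma exists_coupling_empiricalLaw (F : Measure V) [IsProbabilityMeasure F] (T : SimpleFunc V V)
    {n : ℕ} (hn : n ≠ 0) (z z' : Fin n → V) :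
    ∃ π : Measure (V × V), π.map Prod.fst = F ∧ π.map Prod.snd = empiricalLaw z' ∧
      ∫⁻ t, ‖t.1 - t.2‖ₑ ^ 2 ∂π ≤ 4 * (∫⁻ v, ‖v - T v‖ₑ ^ 2 ∂F
        + (∑ k ∈ T.range, ∑ l ∈ T.range, ‖k - l‖ₑ ^ 2) * ∑ k ∈ T.range, (F (T ⁻¹' {k})
          - (n : ℝ≥0∞)⁻¹ * ∑ i, (T ⁻¹' {k}).indicator 1 (z i))
        + (n : ℝ≥0∞)⁻¹ * ∑ i, ‖T (z i) - z i‖ₑ ^ 2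
        + (n : ℝ≥0∞)⁻¹ * ∑ i, ‖z i - z' i‖ₑ ^ 2) := by
  set R := ∑ k ∈ T.range, ∑ l ∈ T.range, ‖k - l‖ₑ ^ 2
  have hmem : ∀ v, T v ∈ T.range := fun v => SimpleFunc.mem_range_self T v
  -- F is coupled with the uniform law on indices rather than on points, so that one index i
  -- determines both z i and z' i.
  set U : Measure (Fin n) := empiricalLaw id
  have : IsProbabilityMeasure U := isProbabilityMeasure_empiricalLaw hn _
  obtain ⟨π, h1, h2, h3⟩ := exists_coupling_fiber F U (κ := T.range)
    (T := fun v => ⟨T v, hmem v⟩) (T' := fun i => ⟨T (z i), hmem _⟩)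
    (T.measurable.subtype_mk) (measurable_of_finite _)
  have hz' : Measurable z' := measurable_of_finite _
  have hz : Measurable z := measurable_of_finite _
  have hpm : Measurable fun t : V × Fin n => (t.1, z' t.2) := by fun_prop
  refine ⟨π.map fun t => (t.1, z' t.2), ?_, ?_, ?_⟩
  · rw [Measure.map_map measurable_fst hpm]; exact h1
  · rw [Measure.map_map measurable_snd hpm]
    change π.map (z' ∘ Prod.snd) = _
    rw [← Measure.map_map hz' measurable_snd, h2, empiricalLaw_map _ hz']
    rfl
  rw [lintegral_map (by fun_prop) hpm]
  have hTm := T.measurable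
  have e1 : ∫⁻ t, ‖t.1 - T t.1‖ₑ ^ 2 ∂π = ∫⁻ v, ‖v - T v‖ₑ ^ 2 ∂F := by
    rw [← h1, lintegral_map (by fun_prop) measurable_fst]
  -- The integrand vanishes when the cells agree and is at most R otherwise, R being the sum of all
  -- squared distances between values of T.
  have e2 : ∫⁻ t, ‖T t.1 - T (z t.2)‖ₑ ^ 2 ∂π ≤ R * ∑ k ∈ T.range, (F (T ⁻¹' {k})
      - (n : ℝ≥0∞)⁻¹ * ∑ i, (T ⁻¹' {k}).indicator 1 (z i)) := by
    have hms : MeasurableSet {t : V × Fin n | T t.1 ≠ T (z t.2)} :=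
      (measurableSet_eq_fun (hTm.comp measurable_fst)
        (hTm.comp (hz.comp measurable_snd))).compl
    calc ∫⁻ t, ‖T t.1 - T (z t.2)‖ₑ ^ 2 ∂π
        ≤ ∫⁻ t, {t : V × Fin n | T t.1 ≠ T (z t.2)}.indicator (fun _ => R) t ∂π := by
          refine lintegral_mono fun t => ?_
          by_cases h : T t.1 = T (z t.2)
          · simp [h]
          · rw [Set.indicator_of_mem (by exact h)]
            exact (Finset.single_le_sum (f := fun l => ‖T t.1 - l‖ₑ ^ 2) (fun _ _ => zero_le)
              (hmem (z t.2))).trans (Finset.single_le_sum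
              (f := fun k => ∑ l ∈ T.range, ‖k - l‖ₑ ^ 2) (fun _ _ => zero_le) (hmem t.1))
      _ = R * π {t | T t.1 ≠ T (z t.2)} := by rw [lintegral_indicator_const hms]
      _ ≤ R * ∑ k : T.range, (F (T ⁻¹' {(k : V)})
            - (n : ℝ≥0∞)⁻¹ * ∑ i, (T ⁻¹' {(k : V)}).indicator 1 (z i)) := by
          gcongr
          simp only [ne_eq, Subtype.mk.injEq] at h3
          refine h3.trans (Finset.sum_le_sum fun k _ => le_of_eq ?_)
          congr 1
          · congr 1; ext v; simp [Subtype.ext_iff]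
          · rw [← lintegral_indicator_one (MeasurableSet.of_discrete),
              lintegral_empiricalLaw _ (measurable_of_finite _)]
            congr 1
            refine Finset.sum_congr rfl fun i _ => ?_
            classical
            rw [Set.indicator_apply, Set.indicator_apply]
            exact if_congr (Subtype.ext_iff (a1 := ⟨T (z i), hmem (z i)⟩) (a2 := k)) rfl rfl
      _ = _ := by rw [Finset.sum_coe_sort T.range fun k => (F (T ⁻¹' {k})
            - (n : ℝ≥0∞)⁻¹ * ∑ i, (T ⁻¹' {k}).indicator 1 (z i))]
  have e3 : ∀ φ : Fin n → ℝ≥0∞, ∫⁻ t, φ t.2 ∂π = (n : ℝ≥0∞)⁻¹ * ∑ i, φ i := fun φ => by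
    have hφ : Measurable φ := measurable_of_finite _
    rw [← lintegral_map (f := φ) hφ measurable_snd, h2, lintegral_empiricalLaw _ hφ]
    rfl
  calc ∫⁻ t, ‖t.1 - z' t.2‖ₑ ^ 2 ∂π
      ≤ ∫⁻ t, 4 * (‖t.1 - T t.1‖ₑ ^ 2 + ‖T t.1 - T (z t.2)‖ₑ ^ 2 + ‖T (z t.2) - z t.2‖ₑ ^ 2
          + ‖z t.2 - z' t.2‖ₑ ^ 2) ∂π := lintegral_mono fun t => enorm_sub_sq_le_four _ _ _ _ _
    _ = 4 * (∫⁻ t, ‖t.1 - T t.1‖ₑ ^ 2 ∂π + ∫⁻ t, ‖T t.1 - T (z t.2)‖ₑ ^ 2 ∂π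
          + ∫⁻ t, ‖T (z t.2) - z t.2‖ₑ ^ 2 ∂π + ∫⁻ t, ‖z t.2 - z' t.2‖ₑ ^ 2 ∂π) := by
        rw [lintegral_const_mul _ (by fun_prop), lintegral_add_left (by fun_prop),
          lintegral_add_left (by fun_prop), lintegral_add_left (by fun_prop)]
    _ ≤ _ := by
        rw [e1, e3 fun i => ‖T (z i) - z i‖ₑ ^ 2, e3 fun i => ‖z i - z' i‖ₑ ^ 2]
        gcongr

end Empirical

/-! ### Strong laws and moments of averages. -/

section StrongLaw

/-- The sum of the f n has finite integral, hence is almost surely finite, and its terms tend to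
zero. -/
lemma ae_tendsto_zero_of_lintegral_le {Ω : Type*} [MeasurableSpace Ω] {μ : Measure Ω}
    {f : ℕ → Ω → ℝ≥0∞} (hf : ∀ n, AEMeasurable (f n) μ)
    {u : ℕ → ℝ} (hu : Summable u) (hle : ∀ n, ∫⁻ ω, f n ω ∂μ ≤ ENNReal.ofReal (u n)) :
    ∀ᵐ ω ∂μ, Tendsto (fun n => f n ω) atTop (𝓝 0) := by
  have h : ∫⁻ ω, ∑' n, f n ω ∂μ ≠ ∞ := by
    rw [lintegral_tsum hf]
    exact ne_top_of_le_ne_top hu.tsum_ofReal_ne_top (ENNReal.tsum_le_tsum hle)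
  filter_upwards [ae_lt_top' (AEMeasurable.tsum hf) h] with ω hω
  exact ENNReal.tendsto_atTop_zero_of_tsum_ne_top hω.ne

variable {Ω : Type*} [MeasurableSpace Ω] {μ : Measure Ω}
  {V : Type*} [MeasurableSpace V] {ξ : ℕ → Ω → V}

/-- The strong law of large numbers for a nonnegative integrable function of an i.i.d. sequence,
in extended form. -/
lemma strong_law_lintegral (hm : ∀ i, Measurable (ξ i))
    (hindep : Pairwise fun i j => IndepFun (ξ i) (ξ j) μ)
    (hident : ∀ i, IdentDistrib (ξ i) (ξ 0) μ μ) {φ : V → ℝ≥0∞} (hφ : Measurable φ)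
    (hfin : ∀ v, φ v ≠ ∞) (hint : ∫⁻ v, φ v ∂(μ.map (ξ 0)) ≠ ∞) :
    ∀ᵐ ω ∂μ, Tendsto (fun n : ℕ => (n : ℝ≥0∞)⁻¹ * ∑ i : Fin n, φ (ξ i ω)) atTop
      (𝓝 (∫⁻ v, φ v ∂(μ.map (ξ 0)))) := by
  have hφr : Measurable fun v => (φ v).toReal := hφ.ennreal_toReal
  have hint' : ∫⁻ ω, φ (ξ 0 ω) ∂μ ≠ ∞ := by rwa [lintegral_map hφ (hm 0)] at hint
  have hslln := strong_law_ae_real (μ := μ) (fun i ω => (φ (ξ i ω)).toReal)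
    (integrable_toReal_of_lintegral_ne_top (hφ.comp (hm 0)).aemeasurable hint')
    (fun i j hij => (hindep hij).comp hφr hφr) (fun i => (hident i).comp hφr)
  filter_upwards [hslln] with ω hω
  rw [integral_toReal (f := fun ω => φ (ξ 0 ω)) (hφ.comp (hm 0)).aemeasurable
    (Eventually.of_forall fun ω => (hfin _).lt_top)] at hω
  have h2 := (ENNReal.continuous_ofReal.tendsto _).comp hω
  rw [ENNReal.ofReal_toReal hint', ← lintegral_map hφ (hm 0)] at h2
  refine h2.congr' ?_
  filter_upwards [eventually_gt_atTop 0] with n hn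
  rw [Function.comp_apply, div_eq_inv_mul, ENNReal.ofReal_mul (by positivity),
    ENNReal.ofReal_inv_of_pos (by exact_mod_cast hn), ENNReal.ofReal_natCast,
    ENNReal.ofReal_sum_of_nonneg fun _ _ => ENNReal.toReal_nonneg,
    Finset.sum_range fun i => ENNReal.ofReal (φ (ξ i ω)).toReal]
  simp only [ENNReal.ofReal_toReal (hfin _)]

lemma lintegral_average (hident : ∀ i, IdentDistrib (ξ i) (ξ 0) μ μ) {b : V → ℝ≥0∞}
    (hb : Measurable b) (hm : ∀ i, Measurable (ξ i)) (n : ℕ) :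
    ∫⁻ ω, (n : ℝ≥0∞)⁻¹ * ∑ i : Fin n, b (ξ i ω) ∂μ ≤ ∫⁻ ω, b (ξ 0 ω) ∂μ := by
  have hbm : ∀ i, Measurable fun ω => b (ξ i ω) := fun i => hb.comp (hm i)
  rw [lintegral_const_mul _ (by fun_prop), lintegral_finsetSum _ fun (i : Fin n) _ => hbm i]
  have h : ∀ i, ∫⁻ ω, b (ξ i ω) ∂μ = ∫⁻ ω, b (ξ 0 ω) ∂μ := fun i =>
    ((hident i).comp hb).lintegral_eq
  simp only [h, Finset.sum_const, Finset.card_univ, Fintype.card_fin, nsmul_eq_mul]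
  rw [← mul_assoc]
  exact mul_le_of_le_one_left zero_le (ENNReal.inv_mul_le_one _)

/-- Off-diagonal terms factorize by pairwise independence; the n diagonal terms carry total weight
1/n. This produces the form of the summability condition in case (b). -/
lemma lintegral_average_sq_le (hindep : Pairwise fun i j => IndepFun (ξ i) (ξ j) μ)
    (hident : ∀ i, IdentDistrib (ξ i) (ξ 0) μ μ) {b : V → ℝ≥0∞}
    (hb : Measurable b) (hm : ∀ i, Measurable (ξ i)) {n : ℕ} (hn : n ≠ 0) :
    ∫⁻ ω, ((n : ℝ≥0∞)⁻¹ * ∑ i : Fin n, b (ξ i ω)) ^ 2 ∂μ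
      ≤ (∫⁻ ω, b (ξ 0 ω) ∂μ) ^ 2 + (n : ℝ≥0∞)⁻¹ * ∫⁻ ω, b (ξ 0 ω) ^ 2 ∂μ := by
  set m := ∫⁻ ω, b (ξ 0 ω) ∂μ
  set v := ∫⁻ ω, b (ξ 0 ω) ^ 2 ∂μ
  have hbm : ∀ i, Measurable fun ω => b (ξ i ω) := fun i => hb.comp (hm i)
  have h1 : ∀ i, ∫⁻ ω, b (ξ i ω) ∂μ = m := fun i => ((hident i).comp hb).lintegral_eq
  have h2 : ∀ i, ∫⁻ ω, b (ξ i ω) * b (ξ i ω) ∂μ = v := fun i => by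
    simp only [← sq]
    exact ((hident i).comp (hb.pow_const 2)).lintegral_eq
  have h3 : ∀ i j : Fin n, ∫⁻ ω, b (ξ i ω) * b (ξ j ω) ∂μ ≤ m ^ 2 + if i = j then v else 0 := by
    intro i j
    by_cases hij : i = j
    · subst hij
      rw [h2, if_pos rfl]
      exact le_add_self
    · have hij' : (i : ℕ) ≠ j := fun h => hij (Fin.ext h)
      have := lintegral_mul_eq_lintegral_mul_lintegral_of_indepFun (hbm i) (hbm j)
        ((hindep hij').comp hb hb)
      simp only [Pi.mul_apply, h1] at this
      rw [this, if_neg hij, add_zero, sq]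
  have hn0 : (n : ℝ≥0∞) ≠ 0 := by exact_mod_cast hn
  have hnt : (n : ℝ≥0∞) ≠ ∞ := ENNReal.natCast_ne_top n
  simp only [mul_pow, sq (∑ _i : Fin n, _), Finset.sum_mul_sum]
  rw [lintegral_const_mul _ (by fun_prop), lintegral_finsetSum _ fun i _ => by fun_prop]
  calc (n : ℝ≥0∞)⁻¹ ^ 2 * ∑ i : Fin n, ∫⁻ ω, ∑ j : Fin n, b (ξ i ω) * b (ξ j ω) ∂μ
      ≤ (n : ℝ≥0∞)⁻¹ ^ 2 * ∑ i : Fin n, ∑ j : Fin n, (m ^ 2 + if i = j then v else 0) := by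
        gcongr with i
        rw [lintegral_finsetSum _ fun j _ => by fun_prop]
        exact Finset.sum_le_sum fun j _ => h3 i j
    _ = (n : ℝ≥0∞)⁻¹ ^ 2 * (n * (n * m ^ 2 + v)) := by
        simp [Finset.sum_add_distrib, mul_add]
    _ = ((n : ℝ≥0∞)⁻¹ * n) * (((n : ℝ≥0∞)⁻¹ * n) * m ^ 2 + (n : ℝ≥0∞)⁻¹ * v) := by ring
    _ = m ^ 2 + (n : ℝ≥0∞)⁻¹ * v := by
        rw [ENNReal.inv_mul_cancel hn0 hnt, one_mul, one_mul]

end StrongLaw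

/-! ### Almost sure convergence of empirical laws in quadratic cost. -/

section Varadarajan

lemma exists_simpleFunc_lintegral_le {V : Type*} [NormedAddCommGroup V] [MeasurableSpace V]
    {F : Measure V} [IsFiniteMeasure F]
    (hF : MemLp (fun v : V => v) 2 F) {ε : ℝ≥0∞} (hε : ε ≠ 0) :
    ∃ T : SimpleFunc V V, ∫⁻ v, ‖v - T v‖ₑ ^ 2 ∂F ≤ ε := by
  have hε' : ε ^ (1 / 2 : ℝ) ≠ 0 := by simp [ENNReal.rpow_eq_zero_iff, hε]
  obtain ⟨T, hT, -⟩ := hF.exists_simpleFunc_eLpNorm_sub_lt ENNReal.ofNat_ne_top hε'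
  refine ⟨T, ?_⟩
  have h := eLpNorm_nnreal_pow_eq_lintegral (μ := F) (f := (fun v : V => v) - ⇑T)
    (p := 2) two_ne_zero
  simp only [Pi.sub_apply, NNReal.coe_ofNat, ENNReal.rpow_ofNat, ENNReal.coe_ofNat] at h
  rw [← h]
  calc eLpNorm ((fun v : V => v) - ⇑T) 2 F ^ 2 ≤ (ε ^ (1 / 2 : ℝ)) ^ 2 := by gcongr
    _ = ε := by rw [← ENNReal.rpow_ofNat, ← ENNReal.rpow_mul]; norm_num

variable {Ω : Type*} [MeasurableSpace Ω] {μ : Measure Ω} [IsProbabilityMeasure μ]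
  {V : Type*} [NormedAddCommGroup V] [MeasurableSpace V] [BorelSpace V]
  [SecondCountableTopology V] {ξ : ℕ → Ω → V}

/-- Almost surely, the law of a square-integrable i.i.d. sequence can be coupled with the empirical
laws of its perturbations at vanishing quadratic cost. -/
theorem ae_exists_coupling_empiricalLaw (hm : ∀ i, Measurable (ξ i))
    (hindep : Pairwise fun i j => IndepFun (ξ i) (ξ j) μ)
    (hident : ∀ i, IdentDistrib (ξ i) (ξ 0) μ μ) (hL2 : MemLp (ξ 0) 2 μ)
    (ζ : ℕ → ℕ → Ω → V)
    (hζ : ∀ᵐ ω ∂μ, Tendsto (fun n : ℕ => (n : ℝ≥0∞)⁻¹ * ∑ i : Fin n, ‖ξ i ω - ζ n i ω‖ₑ ^ 2)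
      atTop (𝓝 0)) :
    ∀ᵐ ω ∂μ, ∀ ε : ℝ≥0∞, ε ≠ 0 → ∀ᶠ n : ℕ in atTop, ∃ π : Measure (V × V),
      π.map Prod.fst = μ.map (ξ 0) ∧ π.map Prod.snd = empiricalLaw (fun i : Fin n => ζ n i ω) ∧
        ∫⁻ t, ‖t.1 - t.2‖ₑ ^ 2 ∂π ≤ ε := by
  set F := μ.map (ξ 0)
  have : IsProbabilityMeasure F := Measure.isProbabilityMeasure_map (hm 0).aemeasurable
  have hF : MemLp (fun v : V => v) 2 F :=
    (memLp_map_measure_iff aestronglyMeasurable_id (hm 0).aemeasurable).2 hL2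
  -- The quantization error enters twice, for F and for the sample, with prefactor 4; since 8/16 < 1
  -- the limiting cost stays below 1/(j + 1). Countably many quantizers, each with finite range,
  -- leave one common null set.
  have hε : ∀ j : ℕ, ((16 * (j + 1) : ℕ) : ℝ≥0∞)⁻¹ ≠ 0 := fun j =>
    ENNReal.inv_ne_zero.2 (ENNReal.natCast_ne_top _)
  choose T hT using fun j : ℕ => exists_simpleFunc_lintegral_le hF (hε j)
  have hTfin : ∀ j, ∫⁻ v, ‖v - T j v‖ₑ ^ 2 ∂F ≠ ∞ := fun j =>
    ne_top_of_le_ne_top (ENNReal.inv_ne_top.2 (by positivity)) (hT j)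
  have hslln1 : ∀ᵐ ω ∂μ, ∀ j : ℕ, Tendsto
      (fun n : ℕ => (n : ℝ≥0∞)⁻¹ * ∑ i : Fin n, ‖T j (ξ i ω) - ξ i ω‖ₑ ^ 2) atTop
      (𝓝 (∫⁻ v, ‖v - T j v‖ₑ ^ 2 ∂F)) := by
    rw [ae_all_iff]
    intro j
    have hTm := (T j).measurable
    simp only [enorm_sub_rev (T j _)]
    exact strong_law_lintegral hm hindep hident (φ := fun v => ‖v - T j v‖ₑ ^ 2) (by fun_prop)
      (fun v => by finiteness) (hTfin j)
  have hslln2 : ∀ᵐ ω ∂μ, ∀ j : ℕ, ∀ k : (T j).range, Tendsto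
      (fun n : ℕ => (n : ℝ≥0∞)⁻¹ * ∑ i : Fin n, (T j ⁻¹' {(k : V)}).indicator 1 (ξ i ω)) atTop
      (𝓝 (F (T j ⁻¹' {(k : V)}))) := by
    rw [ae_all_iff]
    intro j
    rw [ae_all_iff]
    intro k
    have hms : MeasurableSet (T j ⁻¹' {(k : V)}) := (T j).measurableSet_fiber _
    rw [← lintegral_indicator_one hms]
    refine strong_law_lintegral hm hindep hident (measurable_one.indicator hms) (fun v => ?_) ?_
    · by_cases h : v ∈ T j ⁻¹' {(k : V)} <;> simp [h]
    · rw [lintegral_indicator_one hms]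
      exact measure_ne_top _ _
  filter_upwards [hslln1, hslln2, hζ] with ω h1 h2 h3 ε hε
  obtain ⟨j, hj⟩ : ∃ j : ℕ, ((j + 1 : ℕ) : ℝ≥0∞)⁻¹ < ε := by
    obtain ⟨j, hj⟩ := ENNReal.exists_inv_nat_lt hε
    refine ⟨j, lt_of_le_of_lt ?_ hj⟩
    gcongr
    exact Nat.le_succ j
  have hlim : Tendsto (fun n : ℕ => 4 * (∫⁻ v, ‖v - T j v‖ₑ ^ 2 ∂F
        + (∑ k ∈ (T j).range, ∑ l ∈ (T j).range, ‖k - l‖ₑ ^ 2) * ∑ k ∈ (T j).range,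
          (F (T j ⁻¹' {k}) - (n : ℝ≥0∞)⁻¹ * ∑ i : Fin n, (T j ⁻¹' {k}).indicator 1 (ξ i ω))
        + (n : ℝ≥0∞)⁻¹ * ∑ i : Fin n, ‖T j (ξ i ω) - ξ i ω‖ₑ ^ 2
        + (n : ℝ≥0∞)⁻¹ * ∑ i : Fin n, ‖ξ i ω - ζ n i ω‖ₑ ^ 2)) atTop
      (𝓝 (4 * (∫⁻ v, ‖v - T j v‖ₑ ^ 2 ∂F
        + (∑ k ∈ (T j).range, ∑ l ∈ (T j).range, ‖k - l‖ₑ ^ 2) * ∑ k ∈ (T j).range,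
          (F (T j ⁻¹' {k}) - F (T j ⁻¹' {k}))
        + ∫⁻ v, ‖v - T j v‖ₑ ^ 2 ∂F + 0))) := by
    refine ENNReal.Tendsto.const_mul (((tendsto_const_nhds.add (ENNReal.Tendsto.const_mul
      (tendsto_finsetSum _ fun k hk => ENNReal.Tendsto.sub tendsto_const_nhds (h2 j ⟨k, hk⟩)
        (Or.inl (measure_ne_top _ _))) (Or.inr ?_))).add (h1 j)).add h3) (Or.inr (by norm_num))
    exact ENNReal.sum_ne_top.2 fun k _ => ENNReal.sum_ne_top.2 fun l _ => by finiteness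
  have hlt : 4 * (∫⁻ v, ‖v - T j v‖ₑ ^ 2 ∂F
        + (∑ k ∈ (T j).range, ∑ l ∈ (T j).range, ‖k - l‖ₑ ^ 2) * ∑ k ∈ (T j).range,
          (F (T j ⁻¹' {k}) - F (T j ⁻¹' {k}))
        + ∫⁻ v, ‖v - T j v‖ₑ ^ 2 ∂F + 0) < ε := by
    simp only [tsub_self, Finset.sum_const_zero, mul_zero, add_zero]
    refine lt_of_le_of_lt ?_ hj
    calc 4 * (∫⁻ v, ‖v - T j v‖ₑ ^ 2 ∂F + ∫⁻ v, ‖v - T j v‖ₑ ^ 2 ∂F)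
        ≤ 4 * (((16 * (j + 1) : ℕ) : ℝ≥0∞)⁻¹ + ((16 * (j + 1) : ℕ) : ℝ≥0∞)⁻¹) := by
          gcongr <;> exact hT j
      _ = (8 * (16 : ℝ≥0∞)⁻¹) * ((j + 1 : ℕ) : ℝ≥0∞)⁻¹ := by
          rw [Nat.cast_mul, ENNReal.mul_inv (Or.inl (by norm_num)) (Or.inl (by norm_num))]
          push_cast
          ring
      _ ≤ 1 * ((j + 1 : ℕ) : ℝ≥0∞)⁻¹ := by
          gcongr
          calc (8 : ℝ≥0∞) * 16⁻¹ ≤ 16 * 16⁻¹ := by gcongr; norm_num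
            _ = 1 := ENNReal.mul_inv_cancel (by norm_num) (by norm_num)
      _ = ((j + 1 : ℕ) : ℝ≥0∞)⁻¹ := one_mul _
  filter_upwards [hlim.eventually_lt_const hlt, eventually_gt_atTop 0] with n hn hn0
  obtain ⟨π, p1, p2, p3⟩ := exists_coupling_empiricalLaw F (T j) hn0.ne'
    (fun i : Fin n => ξ i ω) (fun i : Fin n => ζ n i ω)
  exact ⟨π, p1, p2, p3.trans hn.le⟩

end Varadarajan

/-! ### Discretization of paths along a partition. -/

lemma ae_unitInterval_ne_zero : ∀ᵐ t : unitInterval, t ≠ 0 := by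
  rw [ae_iff]
  simp

lemma sq_lintegral_le {α : Type*} [MeasurableSpace α] {μ : Measure α} [IsProbabilityMeasure μ]
    {f : α → ℝ≥0∞} (hf : AEMeasurable f μ) : (∫⁻ a, f a ∂μ) ^ 2 ≤ ∫⁻ a, f a ^ 2 ∂μ := by
  have h := ENNReal.lintegral_mul_le_Lp_mul_Lq μ Real.HolderConjugate.two_two hf
    (aemeasurable_const (b := (1 : ℝ≥0∞)))
  simp only [Pi.mul_apply, mul_one, ENNReal.one_rpow, lintegral_const, measure_univ] at h
  calc (∫⁻ a, f a ∂μ) ^ 2 ≤ ((∫⁻ a, f a ^ (2 : ℝ) ∂μ) ^ (1 / 2 : ℝ)) ^ 2 := by gcongr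
    _ = ∫⁻ a, f a ^ 2 ∂μ := by
        rw [← ENNReal.rpow_ofNat, ← ENNReal.rpow_mul]
        norm_num

namespace UnitPartition

variable (P : UnitPartition)

lemma p_ne_zero : P.p ≠ 0 := by
  intro h
  have h1 : Fin.last P.p = 0 := Fin.ext (by simp [h])
  have h2 := P.last
  rw [h1, P.first] at h2
  exact zero_ne_one h2

lemma sub_le_mesh (i : Fin P.p) : (P.t i.succ : ℝ) - P.t i.castSucc ≤ P.mesh :=
  le_ciSup (f := fun i : Fin P.p => (P.t i.succ : ℝ) - (P.t i.castSucc : ℝ))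
    (Set.finite_range _).bddAbove i

lemma mesh_nonneg : 0 ≤ P.mesh := by
  have i : Fin P.p := ⟨0, Nat.pos_of_ne_zero P.p_ne_zero⟩
  refine le_trans ?_ (P.sub_le_mesh i)
  have : P.t i.castSucc ≤ P.t i.succ := (P.strictMono Fin.castSucc_lt_succ).le
  exact sub_nonneg.2 this

lemma mesh_le_one : P.mesh ≤ 1 := by
  have : Nonempty (Fin P.p) := ⟨⟨0, Nat.pos_of_ne_zero P.p_ne_zero⟩⟩
  refine ciSup_le fun i => ?_
  linarith [(P.t i.succ).2.2, (P.t i.castSucc).2.1]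

/-- The point u is the right end of the cell containing s and does not depend on the path. The
origin lies in no half-open cell, so the discretized path is 0 there. -/
lemma exists_discretize_eq {s : unitInterval} (hs : s ≠ 0) :
    ∃ u : unitInterval, |(s : ℝ) - u| ≤ P.mesh ∧
      ∀ x : unitInterval → ℝ, P.discretize x s = x u := by
  have hmono := P.strictMono.monotone
  -- The least such k is positive because s ≠ 0, and minimality puts s strictly to the right of the
  -- preceding point.
  have hex : ∃ k : ℕ, ∃ h : k < P.p + 1, s ≤ P.t ⟨k, h⟩ :=
    ⟨P.p, Nat.lt_succ_self _, by
      have := P.last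
      rw [show (⟨P.p, Nat.lt_succ_self _⟩ : Fin (P.p + 1)) = Fin.last P.p from rfl, this]
      exact unitInterval.le_one'⟩
  classical
  obtain ⟨hk, hsk⟩ := Nat.find_spec hex
  set k := Nat.find hex
  have hk0 : k ≠ 0 := by
    intro h
    have h2 : (⟨k, hk⟩ : Fin (P.p + 1)) = 0 := Fin.ext (by simp [h])
    rw [h2, P.first] at hsk
    exact hs (le_antisymm hsk unitInterval.nonneg')
  obtain ⟨j, hj⟩ := Nat.exists_eq_succ_of_ne_zero hk0
  have hjp : j < P.p := by omega
  set i : Fin P.p := ⟨j, hjp⟩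
  have hsucc : i.succ = ⟨k, hk⟩ := Fin.ext (by simp [i, hj])
  have hlt : P.t i.castSucc < s := by
    by_contra hcon
    exact Nat.find_min hex (show j < k by omega) ⟨by omega, not_lt.1 hcon⟩
  rw [← hsucc] at hsk
  refine ⟨P.t i.succ, ?_, fun x => ?_⟩
  · have h1 : (P.t i.castSucc : ℝ) < s := hlt
    have h2 : (s : ℝ) ≤ P.t i.succ := hsk
    rw [abs_le]
    constructor <;> linarith [P.sub_le_mesh i]
  · unfold discretize
    rw [Finset.sum_eq_single i]
    · exact Set.indicator_of_mem (show s ∈ Set.Ioc _ _ from ⟨hlt, hsk⟩) _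
    · intro l _ hl
      refine Set.indicator_of_notMem (fun hmem : s ∈ Set.Ioc _ _ => ?_) _
      rcases lt_or_gt_of_ne hl with h | h
      · have : P.t l.succ ≤ P.t i.castSucc := hmono (Fin.succ_le_castSucc_iff.2 h)
        exact absurd (hmem.2.trans this) (not_le.2 hlt)
      · have : P.t i.succ ≤ P.t l.castSucc := hmono (Fin.succ_le_castSucc_iff.2 h)
        exact absurd (hsk.trans this) (not_le.2 hmem.1)
    · simp

lemma measurable_discretize_uncurry {Ω : Type*} [MeasurableSpace Ω] {X : unitInterval → Ω → ℝ}
    (hX : Measurable (Function.uncurry X)) :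
    Measurable fun q : Ω × unitInterval => P.discretize (fun t => X t q.1) q.2 := by
  unfold discretize
  refine Finset.measurable_sum _ fun i _ => ?_
  have h : Measurable fun q : Ω × unitInterval => X (P.t i.succ) q.1 :=
    hX.comp (measurable_const.prodMk measurable_fst)
  exact h.indicator (s := {q : Ω × unitInterval | q.2 ∈ Set.Ioc (P.t i.castSucc) (P.t i.succ)})
    (measurable_snd measurableSet_Ioc)

lemma memLp_discretize (x : unitInterval → ℝ) : MemLp (P.discretize x) 2 volume := by
  unfold discretize
  exact memLp_finsetSum _ fun i _ => (memLp_const _).indicator measurableSet_Ioc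

/-- Only finitely many values of x enter, linearly; this makes the discretized class measurable for
the product σ-algebra and square-integrable in ω. -/
lemma toL2_discretize (x : unitInterval → ℝ) :
    toL2 (P.discretize x) = ∑ i : Fin P.p, x (P.t i.succ) • indicatorConstLp 2
      (measurableSet_Ioc (a := P.t i.castSucc) (b := P.t i.succ)) (measure_ne_top volume _)
      (1 : ℝ) := by
  rw [toL2, dif_pos (P.memLp_discretize x)]
  refine Lp.ext ?_
  have h : ∀ i : Fin P.p, (x (P.t i.succ) • indicatorConstLp 2
      (measurableSet_Ioc (a := P.t i.castSucc) (b := P.t i.succ)) (measure_ne_top volume _)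
      (1 : ℝ) : L2I) =ᵐ[volume]
      (Set.Ioc (P.t i.castSucc) (P.t i.succ)).indicator (fun _ => x (P.t i.succ)) := fun i => by
    filter_upwards [Lp.coeFn_smul (x (P.t i.succ)) (indicatorConstLp 2
      (measurableSet_Ioc (a := P.t i.castSucc) (b := P.t i.succ)) (measure_ne_top volume _)
      (1 : ℝ)), indicatorConstLp_coeFn (p := 2) (hs := measurableSet_Ioc (a := P.t i.castSucc)
        (b := P.t i.succ)) (hμs := measure_ne_top volume _) (c := (1 : ℝ))] with s h1 h2
    rw [h1, Pi.smul_apply, h2]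
    by_cases hs : s ∈ Set.Ioc (P.t i.castSucc) (P.t i.succ) <;> simp [hs]
  filter_upwards [MemLp.coeFn_toLp (P.memLp_discretize x), Lp.coeFn_finsetSum Finset.univ
    fun i : Fin P.p => (x (P.t i.succ) • indicatorConstLp 2
      (measurableSet_Ioc (a := P.t i.castSucc) (b := P.t i.succ)) (measure_ne_top volume _)
      (1 : ℝ) : L2I), ae_all_iff.2 h] with s h1 h2 h3
  rw [h1, h2, Finset.sum_apply]
  simp only [h3]
  rfl

lemma measurable_toL2_discretize :
    Measurable fun x : unitInterval → ℝ => toL2 (P.discretize x) := by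
  simp only [toL2_discretize]
  exact Finset.measurable_sum _ fun i _ => (measurable_pi_apply _).smul_const _

end UnitPartition

/-- If x is not square-integrable, its class defaults to 0, but the right side is then infinite. -/
lemma enorm_toL2_sub_sq_le {x y : unitInterval → ℝ} (hx : AEStronglyMeasurable x volume)
    (hy : MemLp y 2 volume) : ‖toL2 x - toL2 y‖ₑ ^ 2 ≤ ∫⁻ t, ‖x t - y t‖ₑ ^ 2 := by
  have h := eLpNorm_nnreal_pow_eq_lintegral (μ := (volume : Measure unitInterval)) (f := x - y)
    (p := 2) two_ne_zero
  simp only [Pi.sub_apply, NNReal.coe_ofNat, ENNReal.rpow_ofNat, ENNReal.coe_ofNat] at h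
  rw [← h]
  by_cases hfin : eLpNorm (x - y) 2 volume = ∞
  · simp [hfin]
  · have hxy : MemLp (x - y) 2 volume := ⟨hx.sub hy.1, lt_top_iff_ne_top.2 hfin⟩
    have hx2 : MemLp x 2 volume := by simpa using hxy.add hy
    rw [toL2, toL2, dif_pos hx2, dif_pos hy, ← MemLp.toLp_sub, Lp.enorm_toLp]

/-! ### Moments of the discretization error. -/

section PathDiscretization

variable {Ω : Type*} [MeasurableSpace Ω] {μ : Measure Ω} [IsProbabilityMeasure μ]

/-- The integrated power of the discretization error of a process. -/
noncomputable def discretizationError (X : unitInterval → Ω → ℝ) (P : UnitPartition) (q : ℕ)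
    (ω : Ω) : ℝ≥0∞ :=
  ∫⁻ t, (‖X t ω - P.discretize (fun t => X t ω) t‖ₑ ^ 2) ^ q

lemma measurable_discretizationError_integrand {X : unitInterval → Ω → ℝ}
    (hX : Measurable (Function.uncurry X)) (P : UnitPartition) (q : ℕ) :
    Measurable fun r : Ω × unitInterval =>
      (‖X r.2 r.1 - P.discretize (fun t => X t r.1) r.2‖ₑ ^ 2) ^ q :=
  (((hX.comp measurable_swap).sub
    (P.measurable_discretize_uncurry hX)).enorm.pow_const 2).pow_const q

lemma measurable_discretizationError {X : unitInterval → Ω → ℝ}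
    (hX : Measurable (Function.uncurry X)) (P : UnitPartition) (q : ℕ) :
    Measurable (discretizationError X P q) :=
  (measurable_discretizationError_integrand hX P q).lintegral_prod_right'

/-- For q = 2 this is Cauchy–Schwarz on the probability space [0,1]. -/
lemma enorm_toL2_sub_discretize_le {X : unitInterval → Ω → ℝ}
    (hX : Measurable (Function.uncurry X)) (P : UnitPartition) {q : ℕ} (hq : q = 1 ∨ q = 2)
    (ω : Ω) : (‖toL2 (fun t => X t ω) - toL2 (P.discretize fun t => X t ω)‖ₑ ^ 2) ^ q
      ≤ discretizationError X P q ω := by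
  have hXω : Measurable fun t => X t ω := (hX.comp measurable_swap).comp measurable_prodMk_left
  have h1 : ‖toL2 (fun t => X t ω) - toL2 (P.discretize fun t => X t ω)‖ₑ ^ 2
      ≤ ∫⁻ t, ‖X t ω - P.discretize (fun t => X t ω) t‖ₑ ^ 2 :=
    enorm_toL2_sub_sq_le hXω.aestronglyMeasurable (P.memLp_discretize _)
  refine (pow_le_pow_left₀ zero_le h1 q).trans ?_
  unfold discretizationError
  rcases hq with rfl | rfl
  · simp
  · have hdω : Measurable fun t => P.discretize (fun t => X t ω) t :=
      (P.measurable_discretize_uncurry hX).comp measurable_prodMk_left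
    exact sq_lintegral_le ((hXω.sub hdω).enorm.pow_const 2).aemeasurable

/-- The moments of the discretization error are controlled by those of the increments. -/
lemma lintegral_discretizationError_le {X : unitInterval → Ω → ℝ}
    (hX : Measurable (Function.uncurry X)) (P : UnitPartition) (q : ℕ) {B : ℝ≥0∞}
    (hB : ∀ s t : unitInterval, |(s : ℝ) - t| ≤ P.mesh →
      ∫⁻ ω, (‖X s ω - X t ω‖ₑ ^ 2) ^ q ∂μ ≤ B) :
    ∫⁻ ω, discretizationError X P q ω ∂μ ≤ B := by
  calc ∫⁻ ω, discretizationError X P q ω ∂μ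
      = ∫⁻ t, ∫⁻ ω, (‖X t ω - P.discretize (fun t => X t ω) t‖ₑ ^ 2) ^ q ∂μ ∂volume :=
        lintegral_lintegral_swap (measurable_discretizationError_integrand hX P q).aemeasurable
    _ ≤ ∫⁻ _t : unitInterval, B := by
        refine lintegral_mono_ae ?_
        filter_upwards [ae_unitInterval_ne_zero] with t ht
        obtain ⟨u, hu, hdisc⟩ := P.exists_discretize_eq ht
        simp only [hdisc]
        exact hB t u hu
    _ = B := by simp

lemma enorm_pathPair_sub_sq_le (x y x' y' : unitInterval → ℝ) :
    ‖pathPair x y - pathPair x' y'‖ₑ ^ 2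
      ≤ ‖toL2 x - toL2 x'‖ₑ ^ 2 + ‖toL2 y - toL2 y'‖ₑ ^ 2 := by
  have h : ‖pathPair x y - pathPair x' y'‖ₑ = max ‖toL2 x - toL2 x'‖ₑ ‖toL2 y - toL2 y'‖ₑ := rfl
  rw [h]
  rcases le_total ‖toL2 x - toL2 x'‖ₑ ‖toL2 y - toL2 y'‖ₑ with h | h
  · rw [max_eq_right h]; exact le_add_self
  · rw [max_eq_left h]; exact le_self_add

/-- The discretized pair of paths, as a function of the trajectory of the pair. -/
noncomputable def discretePair (P : UnitPartition) (w : unitInterval → ℝ × ℝ) : PathPair :=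
  pathPair (P.discretize fun t => (w t).1) (P.discretize fun t => (w t).2)

lemma measurable_discretePair (P : UnitPartition) : Measurable (discretePair P) := by
  have h1 : Measurable fun w : unitInterval → ℝ × ℝ => fun t => (w t).1 := by fun_prop
  have h2 : Measurable fun w : unitInterval → ℝ × ℝ => fun t => (w t).2 := by fun_prop
  exact (P.measurable_toL2_discretize.comp h1).prodMk (P.measurable_toL2_discretize.comp h2)

lemma add_pow_le_four_mul {a b : ℝ≥0∞} {q : ℕ} (hq : q = 1 ∨ q = 2) :
    (a + b) ^ q ≤ 4 * (a ^ q + b ^ q) := by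
  have key : ∀ {a b : ℝ≥0∞}, a ≤ b → (a + b) ^ q ≤ 4 * (a ^ q + b ^ q) := fun {a b} h =>
    calc (a + b) ^ q ≤ (2 * b) ^ q := by
          gcongr
          rw [two_mul]
          gcongr
      _ = 2 ^ q * b ^ q := mul_pow _ _ _
      _ ≤ 4 * (a ^ q + b ^ q) := by
          gcongr
          · rcases hq with rfl | rfl <;> norm_num
          · exact le_add_self
  rcases le_total a b with h | h
  · exact key h
  · rw [add_comm a, add_comm (a ^ q)]
    exact key h

/-- The moments of the discretization error of a pair of processes. -/
lemma exists_measurable_pathPair_sub_discretePair_le {X Y : unitInterval → Ω → ℝ}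
    (hX : Measurable (Function.uncurry X)) (hY : Measurable (Function.uncurry Y))
    (P : UnitPartition) {q : ℕ} (hq : q = 1 ∨ q = 2) {B B' : ℝ≥0∞}
    (hB : ∀ s t : unitInterval, |(s : ℝ) - t| ≤ P.mesh →
      ∫⁻ ω, (‖X s ω - X t ω‖ₑ ^ 2) ^ q ∂μ ≤ B)
    (hB' : ∀ s t : unitInterval, |(s : ℝ) - t| ≤ P.mesh →
      ∫⁻ ω, (‖Y s ω - Y t ω‖ₑ ^ 2) ^ q ∂μ ≤ B') :
    ∃ g : Ω → ℝ≥0∞, Measurable g ∧ (∀ ω, (‖pathPair (fun t => X t ω) (fun t => Y t ω)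
      - discretePair P (fun t => (X t ω, Y t ω))‖ₑ ^ 2) ^ q ≤ g ω) ∧
      ∫⁻ ω, g ω ∂μ ≤ 4 * (B + B') := by
  have mX := measurable_discretizationError hX P q
  have mY := measurable_discretizationError hY P q
  -- The majorant is measurable by Fubini, which avoids any measurability claim for the L² class of
  -- the path.
  refine ⟨fun ω => 4 * (discretizationError X P q ω + discretizationError Y P q ω),
    (mX.add mY).const_mul 4, fun ω => ?_, ?_⟩
  · refine (pow_le_pow_left₀ zero_le (enorm_pathPair_sub_sq_le _ _ _ _) q).trans ?_
    refine (add_pow_le_four_mul hq).trans ?_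
    beta_reduce
    gcongr
    · exact enorm_toL2_sub_discretize_le hX P hq ω
    · exact enorm_toL2_sub_discretize_le hY P hq ω
  · rw [lintegral_const_mul _ (by fun_prop), lintegral_add_left mX]
    gcongr
    · exact lintegral_discretizationError_le hX P q hB
    · exact lintegral_discretizationError_le hY P q hB'

lemma VarIncrementBound.exists_lintegral_le {X : unitInterval → Ω → ℝ} {γ : ℝ}
    (h : VarIncrementBound μ X γ) (hX2 : ∀ t, MemLp (X t) 2 μ) (hX0 : ∀ t, ∫ ω, X t ω ∂μ = 0) :
    ∃ c : ℝ, 0 ≤ c ∧ ∀ s t : unitInterval,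
      ∫⁻ ω, (‖X s ω - X t ω‖ₑ ^ 2) ^ 1 ∂μ ≤ ENNReal.ofReal (c * |(s : ℝ) - t| ^ γ) := by
  obtain ⟨c, hc, hv⟩ := h
  have key : ∀ s t : unitInterval, s < t → ∫⁻ ω, (‖X t ω - X s ω‖ₑ ^ 2) ^ 1 ∂μ
      ≤ ENNReal.ofReal (c * |(t : ℝ) - s| ^ γ) := by
    intro s t hst
    have hL := (hX2 t).sub (hX2 s)
    have hmean : ∫ ω, (X t ω - X s ω) ∂μ = 0 := by
      rw [integral_sub ((hX2 t).integrable one_le_two) ((hX2 s).integrable one_le_two), hX0, hX0,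
        sub_zero]
    have hvar : variance (X t - X s) μ ≤ _ := hv s t hst
    rw [variance_of_integral_eq_zero hL.1.aemeasurable (by simpa using hmean)] at hvar
    refine le_trans (le_of_eq ?_) (ENNReal.ofReal_le_ofReal hvar)
    rw [ofReal_integral_eq_lintegral_ofReal hL.integrable_sq
      (Eventually.of_forall fun _ => sq_nonneg _)]
    refine lintegral_congr fun ω => ?_
    rw [pow_one, ← ofReal_norm, ← ENNReal.ofReal_pow (norm_nonneg _), Real.norm_eq_abs, sq_abs]
    rfl
  refine ⟨c, hc.le, fun s t => ?_⟩
  rcases lt_trichotomy s t with h | rfl | h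
  · have := key s t h
    rw [abs_sub_comm]
    simpa only [enorm_sub_rev] using this
  · simp
  · exact key t s h

lemma FourthIncrementBound.exists_lintegral_le {Ω : Type*} [MeasurableSpace Ω] {μ : Measure Ω}
    {X : unitInterval → Ω → ℝ} {γ : ℝ}
    (h : FourthIncrementBound μ X γ) :
    ∃ c : ℝ, 0 ≤ c ∧ ∀ s t : unitInterval,
      ∫⁻ ω, (‖X s ω - X t ω‖ₑ ^ 2) ^ 2 ∂μ ≤ ENNReal.ofReal (c * |(s : ℝ) - t| ^ γ) := by
  obtain ⟨c, hc, hv⟩ := h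
  refine ⟨c, hc.le, fun s t => ?_⟩
  obtain ⟨hi, hb⟩ := hv t s
  refine le_trans (le_of_eq ?_) (ENNReal.ofReal_le_ofReal hb)
  rw [ofReal_integral_eq_lintegral_ofReal hi (Eventually.of_forall fun _ => by positivity)]
  refine lintegral_congr fun ω => ?_
  rw [← pow_mul, ← ofReal_norm, ← ENNReal.ofReal_pow (norm_nonneg _), Real.norm_eq_abs]

/-- The mesh is at most 1, so lowering the exponent increases the power; this allows the minimum of
the two exponents. -/
lemma UnitPartition.rpow_le_mesh_rpow (P : UnitPartition) {c d γ γ' : ℝ} (hc : 0 ≤ c)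
    (hd : 0 ≤ d) (hdm : d ≤ P.mesh) (hγ' : 0 ≤ γ') (h : γ' ≤ γ) :
    c * d ^ γ ≤ c * P.mesh ^ γ' := by
  gcongr
  exact (Real.rpow_le_rpow hd hdm (hγ'.trans h)).trans
    (Real.rpow_le_rpow_of_exponent_ge' P.mesh_nonneg P.mesh_le_one hγ' h)

/-- Bounds on the increments give a power of the mesh as bound on the discretization error. -/
lemma exists_discretization_bound {X Y : unitInterval → Ω → ℝ}
    (hX : Measurable (Function.uncurry X)) (hY : Measurable (Function.uncurry Y))
    {q : ℕ} (hq : q = 1 ∨ q = 2) {γX γY : ℝ} (hγX : 0 < γX) (hγY : 0 < γY)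
    (h : ∃ c : ℝ, 0 ≤ c ∧ ∀ s t : unitInterval,
      ∫⁻ ω, (‖X s ω - X t ω‖ₑ ^ 2) ^ q ∂μ ≤ ENNReal.ofReal (c * |(s : ℝ) - t| ^ γX))
    (h' : ∃ c : ℝ, 0 ≤ c ∧ ∀ s t : unitInterval,
      ∫⁻ ω, (‖Y s ω - Y t ω‖ₑ ^ 2) ^ q ∂μ ≤ ENNReal.ofReal (c * |(s : ℝ) - t| ^ γY)) :
    ∃ c : ℝ, 0 ≤ c ∧ ∀ P : UnitPartition, ∃ g : Ω → ℝ≥0∞, Measurable g ∧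
      (∀ ω, (‖pathPair (fun t => X t ω) (fun t => Y t ω)
        - discretePair P (fun t => (X t ω, Y t ω))‖ₑ ^ 2) ^ q ≤ g ω) ∧
      ∫⁻ ω, g ω ∂μ ≤ ENNReal.ofReal (c * P.mesh ^ min γX γY) := by
  obtain ⟨c, hc, hb⟩ := h
  obtain ⟨c', hc', hb'⟩ := h'
  have hm : 0 ≤ min γX γY := (lt_min hγX hγY).le
  refine ⟨4 * (c + c'), by positivity, fun P => ?_⟩
  have hp := Real.rpow_nonneg P.mesh_nonneg (min γX γY)
  obtain ⟨g, hg, hle, hint⟩ := exists_measurable_pathPair_sub_discretePair_le (μ := μ) hX hY P hq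
    (B := ENNReal.ofReal (c * P.mesh ^ min γX γY)) (B' := ENNReal.ofReal (c' * P.mesh ^ min γX γY))
    (fun s t hst => (hb s t).trans (ENNReal.ofReal_le_ofReal
      (P.rpow_le_mesh_rpow hc (abs_nonneg _) hst hm (min_le_left _ _))))
    (fun s t hst => (hb' s t).trans (ENNReal.ofReal_le_ofReal
      (P.rpow_le_mesh_rpow hc' (abs_nonneg _) hst hm (min_le_right _ _))))
  refine ⟨g, hg, hle, hint.trans (le_of_eq ?_)⟩
  rw [← ENNReal.ofReal_add (by positivity) (by positivity), mul_assoc, add_mul,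
    ENNReal.ofReal_mul (by norm_num)]
  simp

end PathDiscretization

/-! ### Cost bound, measurable factorization and vanishing averages. -/

lemma memLp_of_lintegral_enorm_sq {α V : Type*} [MeasurableSpace α] [NormedAddCommGroup V]
    {μ : Measure α} {f : α → V} (hf : AEStronglyMeasurable f μ)
    (h : ∫⁻ a, ‖f a‖ₑ ^ 2 ∂μ ≠ ∞) : MemLp f 2 μ := by
  refine ⟨hf, ?_⟩
  have h2 := eLpNorm_nnreal_pow_eq_lintegral (μ := μ) (f := f) (p := 2) two_ne_zero
  simp only [NNReal.coe_ofNat, ENNReal.rpow_ofNat, ENNReal.coe_ofNat] at h2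
  rw [← h2] at h
  exact lt_top_iff_ne_top.2 fun h3 => h (by simp [h3])

lemma lintegral_enorm_sq {α V : Type*} [MeasurableSpace α] [NormedAddCommGroup V]
    {μ : Measure α} {f : α → V} (hf : MemLp f 2 μ) :
    ∫⁻ a, ‖f a‖ₑ ^ 2 ∂μ = ENNReal.ofReal (∫ a, ‖f a‖ ^ 2 ∂μ) := by
  rw [ofReal_integral_eq_lintegral_ofReal hf.norm.integrable_sq
    (Eventually.of_forall fun _ => sq_nonneg _)]
  refine lintegral_congr fun a => ?_
  rw [← ofReal_norm, ← ENNReal.ofReal_pow (norm_nonneg _)]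

/-- The Mallows distance between the laws of two degenerate `U`-statistics in terms of the
quadratic cost of a coupling and of the second moment of the first law. -/
lemma mallows_uStat_le_of_cost {F G : Measure PathPair} [IsProbabilityMeasure F]
    (hF : MemLp (fun v : PathPair => v) 2 F) {π : Measure (PathPair × PathPair)}
    (h1 : π.map Prod.fst = F) (h2 : π.map Prod.snd = G) {η : ℝ} (hη0 : 0 ≤ η) (hη1 : η ≤ 1)
    (hcost : ∫⁻ t, ‖t.1 - t.2‖ₑ ^ 2 ∂π ≤ ENNReal.ofReal η) {n : ℕ} (hn : n ≠ 0) :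
    mallows ((iidLaw F n).map (uStat F n)) ((iidLaw G n).map (uStat G n))
      ≤ ENNReal.ofReal (2 * (64 ^ 5 * η * (8 * ∫ v, ‖v‖ ^ 2 ∂F + 2))) ^ (1 / 2 : ℝ) := by
  have hπ : IsProbabilityMeasure π := by
    refine ⟨?_⟩
    have h : π.map Prod.fst Set.univ = 1 := by rw [h1]; exact measure_univ
    rwa [Measure.map_apply measurable_fst MeasurableSet.univ] at h
  have hL1 : MemLp (fun w : PathPair × PathPair => w.1) 2 π := by
    rw [← h1] at hF
    exact (memLp_map_measure_iff aestronglyMeasurable_id measurable_fst.aemeasurable).1 hF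
  have hLd : MemLp (fun w : PathPair × PathPair => w.1 - w.2) 2 π :=
    memLp_of_lintegral_enorm_sq (by fun_prop) (ne_top_of_le_ne_top ENNReal.ofReal_ne_top hcost)
  have hL2 : MemLp (fun w : PathPair × PathPair => w.2) 2 π := by
    have h := hL1.sub hLd
    refine h.ae_eq (Eventually.of_forall fun w => ?_)
    simp
  have hgap : ∫ w, gap w ^ 2 ∂π ≤ η := by
    rw [lintegral_enorm_sq hLd] at hcost
    exact (ENNReal.ofReal_le_ofReal_iff hη0).1 hcost
  have hM : ∫ w, ‖w.1‖ ^ 2 ∂π = ∫ v, ‖v‖ ^ 2 ∂F := by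
    rw [← h1, integral_map measurable_fst.aemeasurable (by fun_prop)]
  -- Here `size` ≤ 2‖w.1‖ + `gap`, so its square is at most 8‖w.1‖² + 2 `gap`², and η ≤ 1 bounds the
  -- last mean by 2.
  have hsize : ∫ w, size w ^ 2 ∂π ≤ 8 * ∫ v, ‖v‖ ^ 2 ∂F + 2 := by
    have i1 := hL1.norm.integrable_sq
    have i2 : Integrable (fun w => gap w ^ 2) π := hLd.norm.integrable_sq
    have i3 : Integrable (fun w => size w ^ 2) π := (hL1.norm.add hL2.norm).integrable_sq
    calc ∫ w, size w ^ 2 ∂π ≤ ∫ w, (8 * ‖w.1‖ ^ 2 + 2 * gap w ^ 2) ∂π := by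
          refine integral_mono i3 ((i1.const_mul 8).add (i2.const_mul 2)) fun w => ?_
          have h : ‖w.2‖ ≤ ‖w.1‖ + gap w := by
            have := norm_sub_le w.1 (w.1 - w.2)
            rwa [sub_sub_cancel] at this
          have h' : size w ≤ 2 * ‖w.1‖ + gap w := by unfold size; linarith
          have := pow_le_pow_left₀ (size_nonneg w) h' 2
          beta_reduce
          nlinarith [sq_nonneg (2 * ‖w.1‖ - gap w)]
      _ = 8 * ∫ w, ‖w.1‖ ^ 2 ∂π + 2 * ∫ w, gap w ^ 2 ∂π := by
          rw [integral_add (i1.const_mul 8) (i2.const_mul 2), integral_const_mul,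
            integral_const_mul]
      _ ≤ _ := by rw [hM]; linarith
  have h := mallows_uStat_le hL1 hL2 hn
  rw [h1, h2] at h
  refine h.trans ?_
  gcongr

/-- If random elements are approximated in quadratic mean by measurable functions of given
variables, they are almost surely a common measurable function of those variables. -/
lemma exists_measurable_factor {Ω S V : Type*} [MeasurableSpace Ω] {μ : Measure Ω}
    [MeasurableSpace S] [NormedAddCommGroup V] [CompleteSpace V] [MeasurableSpace V] [BorelSpace V]
    [SecondCountableTopology V] {W : ℕ → Ω → S} {Z : ℕ → Ω → V} {Φ : ℕ → S → V}
    (hΦ : ∀ n, Measurable (Φ n)) {r : ℕ → ℝ} (hr : Tendsto r atTop (𝓝 0))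
    (h : ∀ i, ∃ c : ℝ, 0 ≤ c ∧ ∀ n, ∃ g : Ω → ℝ≥0∞, Measurable g ∧
      (∀ ω, ‖Z i ω - Φ n (W i ω)‖ₑ ^ 2 ≤ g ω) ∧ ∫⁻ ω, g ω ∂μ ≤ ENNReal.ofReal (c * r n)) :
    ∃ Ψ : S → V, Measurable Ψ ∧ ∀ i, Z i =ᵐ[μ] fun ω => Ψ (W i ω) := by
  -- Along this subsequence the squared errors have summable expectations, so convergence is almost
  -- sure. The choice depends on r alone, so the same limit function serves every i.
  obtain ⟨φ, -, hφ⟩ := extraction_forall_of_eventually (P := fun k n => r n ≤ (1 / 2 : ℝ) ^ k)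
    fun k => (hr.eventually_lt_const (by positivity)).mono fun n hn => hn.le
  refine ⟨fun s => limUnder atTop fun k => Φ (φ k) s,
    (StronglyMeasurable.limUnder fun k => (hΦ (φ k)).stronglyMeasurable).measurable, fun i => ?_⟩
  obtain ⟨c, hc, hb⟩ := h i
  choose g hgm hgle hgint using hb
  have hae := ae_tendsto_zero_of_lintegral_le (μ := μ) (f := fun k => g (φ k))
    (fun k => (hgm _).aemeasurable) (u := fun k => c * (1 / 2 : ℝ) ^ k)
    (summable_geometric_two.mul_left c) fun k => (hgint _).trans (ENNReal.ofReal_le_ofReal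
      (mul_le_mul_of_nonneg_left (hφ k) hc))
  filter_upwards [hae] with ω hω
  have h0 : Tendsto (fun k => ‖Z i ω - Φ (φ k) (W i ω)‖ₑ ^ 2) atTop (𝓝 0) :=
    tendsto_of_tendsto_of_tendsto_of_le_of_le tendsto_const_nhds hω (fun _ => zero_le)
      fun k => hgle _ ω
  have h1 := (ENNReal.continuous_rpow_const (y := (1 / 2 : ℝ))).tendsto _ |>.comp h0
  have h2 : Tendsto (fun k => ‖Φ (φ k) (W i ω) - Z i ω‖ₑ) atTop (𝓝 0) := by
    rw [ENNReal.zero_rpow_of_pos (by norm_num)] at h1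
    refine h1.congr fun k => ?_
    rw [Function.comp_apply, ← ENNReal.rpow_ofNat, ← ENNReal.rpow_mul, enorm_sub_rev]
    norm_num
  have h3 : Tendsto (fun k => Φ (φ k) (W i ω)) atTop (𝓝 (Z i ω)) := by
    rw [tendsto_iff_edist_tendsto_0]
    simpa only [edist_eq_enorm_sub] using h2
  exact h3.limUnder_eq.symm

lemma memLp_discretePair {Ω : Type*} [MeasurableSpace Ω] {μ : Measure Ω}
    {X Y : unitInterval → Ω → ℝ} (hX : ∀ t, MemLp (X t) 2 μ) (hY : ∀ t, MemLp (Y t) 2 μ)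
    (P : UnitPartition) : MemLp (fun ω => discretePair P fun t => (X t ω, Y t ω)) 2 μ := by
  have key : ∀ {X : unitInterval → Ω → ℝ}, (∀ t, MemLp (X t) 2 μ) →
      MemLp (fun ω => toL2 (P.discretize fun t => X t ω)) 2 μ := fun hX => by
    simp only [UnitPartition.toL2_discretize]
    exact memLp_finsetSum _ fun i _ => 
      (ContinuousLinearMap.toSpanSingleton ℝ _).comp_memLp' (hX (P.t i.succ))
  exact memLp_prod_iff.2 ⟨key hX, key hY⟩

/-- Averages of nonnegative functions of an i.i.d. sequence tend to zero almost surely when their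
first moments, or suitable combinations of their first two moments, are summable. -/
lemma ae_tendsto_average_zero {Ω S : Type*} [MeasurableSpace Ω] {μ : Measure Ω}
    [IsProbabilityMeasure μ] [MeasurableSpace S] {W : ℕ → Ω → S} (hm : ∀ i, Measurable (W i))
    (hindep : Pairwise fun i j => IndepFun (W i) (W j) μ)
    (hident : ∀ i, IdentDistrib (W i) (W 0) μ μ) {b : ℕ → S → ℝ≥0∞} (hb : ∀ n, Measurable (b n))
    {r : ℕ → ℝ} (hr0 : ∀ n, 0 ≤ r n) {c : ℝ} (hc : 0 ≤ c)
    (h1 : ∀ n, ∫⁻ ω, b n (W 0 ω) ∂μ ≤ ENNReal.ofReal (c * r n))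
    (h : Summable r ∨ ∃ (r' : ℕ → ℝ) (c' : ℝ), (∀ n, 0 ≤ r' n) ∧ 0 ≤ c' ∧
      (∀ n, ∫⁻ ω, b n (W 0 ω) ^ 2 ∂μ ≤ ENNReal.ofReal (c' * r' n)) ∧
      Summable fun n : ℕ => r n ^ 2 + (n : ℝ)⁻¹ * r' n) :
    ∀ᵐ ω ∂μ, Tendsto (fun n : ℕ => (n : ℝ≥0∞)⁻¹ * ∑ i : Fin n, b n (W i ω)) atTop (𝓝 0) := by
  have hbm : ∀ n i, Measurable fun ω => b n (W i ω) := fun n i => (hb n).comp (hm i)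
  rcases h with hs | ⟨r', c', hr', hc', h2, hs⟩
  · exact ae_tendsto_zero_of_lintegral_le (fun n => by fun_prop) (hs.mul_left c)
      fun n => (lintegral_average hident (hb n) hm n).trans (h1 n)
  · have hsq := ae_tendsto_zero_of_lintegral_le (μ := μ)
      (f := fun n ω => ((n : ℝ≥0∞)⁻¹ * ∑ i : Fin n, b n (W i ω)) ^ 2)
      (fun n => by fun_prop) (hs.mul_left (c ^ 2 + c')) fun n => by
        rcases eq_or_ne n 0 with rfl | hn
        -- For n = 0 the empty sum is 0, and ∞ · 0 = 0.
        · simp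
        refine (lintegral_average_sq_le hindep hident (hb n) hm hn).trans ?_
        have hinv : (n : ℝ≥0∞)⁻¹ = ENNReal.ofReal (n : ℝ)⁻¹ := by
          rw [ENNReal.ofReal_inv_of_pos (by positivity), ENNReal.ofReal_natCast]
        have hcr : 0 ≤ c * r n := mul_nonneg hc (hr0 n)
        have hcr' : 0 ≤ c' * r' n := mul_nonneg hc' (hr' n)
        calc (∫⁻ ω, b n (W 0 ω) ∂μ) ^ 2 + (n : ℝ≥0∞)⁻¹ * ∫⁻ ω, b n (W 0 ω) ^ 2 ∂μ
            ≤ ENNReal.ofReal (c * r n) ^ 2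
              + ENNReal.ofReal (n : ℝ)⁻¹ * ENNReal.ofReal (c' * r' n) := by
              rw [hinv]
              gcongr
              · exact h1 n
              · exact h2 n
          _ = ENNReal.ofReal ((c * r n) ^ 2 + (n : ℝ)⁻¹ * (c' * r' n)) := by
              rw [← ENNReal.ofReal_pow hcr, ← ENNReal.ofReal_mul (by positivity),
                ← ENNReal.ofReal_add (by positivity) (by positivity)]
          _ ≤ ENNReal.ofReal ((c ^ 2 + c') * (r n ^ 2 + (n : ℝ)⁻¹ * r' n)) := by
              refine ENNReal.ofReal_le_ofReal ?_
              have p1 : 0 ≤ c' * r n ^ 2 := by positivity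
              have p2 : 0 ≤ c ^ 2 * ((n : ℝ)⁻¹ * r' n) :=
                mul_nonneg (sq_nonneg _) (mul_nonneg (by positivity) (hr' n))
              nlinarith
    filter_upwards [hsq] with ω hω
    have h0 := (ENNReal.continuous_rpow_const (y := (1 / 2 : ℝ))).tendsto _ |>.comp hω
    rw [ENNReal.zero_rpow_of_pos (by norm_num)] at h0
    refine h0.congr fun n => ?_
    rw [Function.comp_apply, ← ENNReal.rpow_ofNat, ← ENNReal.rpow_mul]
    norm_num

/-- The law of the `U`-statistic of an i.i.d. sample. -/
lemma map_uStat_eq {Ω : Type*} [MeasurableSpace Ω] {μ : Measure Ω} [IsProbabilityMeasure μ]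
    {Z : ℕ → Ω → PathPair} {ξ : ℕ → Ω → PathPair} (hZξ : ∀ i, Z i =ᵐ[μ] ξ i)
    (hm : ∀ i, Measurable (ξ i)) (hindep : iIndepFun ξ μ)
    (hident : ∀ i, IdentDistrib (ξ i) (ξ 0) μ μ) (n : ℕ) :
    (μ.map fun ω => uStat (μ.map (Z 0)) n fun i => Z i ω)
      = (iidLaw (μ.map (ξ 0)) n).map (uStat (μ.map (ξ 0)) n) := by
  have : IsProbabilityMeasure (μ.map (ξ 0)) :=
    Measure.isProbabilityMeasure_map (hm 0).aemeasurable
  rw [Measure.map_congr (hZξ 0)]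
  have h1 : (fun ω => uStat (μ.map (ξ 0)) n fun i : Fin n => Z i ω)
      =ᵐ[μ] fun ω => uStat (μ.map (ξ 0)) n fun i : Fin n => ξ i ω := by
    filter_upwards [ae_all_iff.2 hZξ] with ω hω
    simp only [hω]
  have hvm : Measurable fun ω => fun i : Fin n => ξ i ω := measurable_pi_lambda _ fun i => hm i
  rw [Measure.map_congr h1, ← Function.comp_def, ← Measure.map_map (measurable_uStat n) hvm,
    (iIndepFun_iff_map_fun_eq_pi_map fun i : Fin n => (hm i).aemeasurable).1
      (hindep.precomp Fin.val_injective)]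
  simp only [(hident _).map_eq]

end DistCov

/-! ### The bootstrap consistency theorem. -/

theorem proposition5p5
    {Ω : Type*} [MeasurableSpace Ω] (μ : Measure Ω) [IsProbabilityMeasure μ]
    -- the sample `Z_i = (X_i, Y_i)` of pairs of measurable processes on `[0,1]`
    (X Y : ℕ → unitInterval → Ω → ℝ)
    (hXmeas : ∀ i, Measurable (Function.uncurry (X i)))
    (hYmeas : ∀ i, Measurable (Function.uncurry (Y i)))
    -- the pairs are independent and identically distributed
    (hindep : iIndepFun (fun (i : ℕ) (ω : Ω) (t : unitInterval) => (X i t ω, Y i t ω)) μ)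
    (hident : ∀ i, IdentDistrib (fun (ω : Ω) (t : unitInterval) => (X i t ω, Y i t ω))
      (fun (ω : Ω) (t : unitInterval) => (X 0 t ω, Y 0 t ω)) μ μ)
    -- the two components are independent, centered, with finite second moments
    (hXY : IndepFun (fun (ω : Ω) (t : unitInterval) => X 0 t ω)
      (fun (ω : Ω) (t : unitInterval) => Y 0 t ω) μ)
    (hX2 : ∀ t, MemLp (X 0 t) 2 μ) (hY2 : ∀ t, MemLp (Y 0 t) 2 μ)
    (hX0 : ∀ t, ∫ ω, X 0 t ω ∂μ = 0) (hY0 : ∀ t, ∫ ω, Y 0 t ω ∂μ = 0)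
    -- smoothness of the increments
    (γX γY : ℝ) (hγX : 0 < γX) (hγY : 0 < γY)
    (hXinc : DistCov.VarIncrementBound μ (X 0) γX)
    (hYinc : DistCov.VarIncrementBound μ (Y 0) γY)
    -- the partitions and their meshes
    (P : ℕ → DistCov.UnitPartition)
    (hδ : (Summable fun n : ℕ => (P n).mesh ^ min γX γY) ∨
      ∃ γX' γY' : ℝ, 0 < γX' ∧ 0 < γY' ∧
        DistCov.FourthIncrementBound μ (X 0) γX' ∧
        DistCov.FourthIncrementBound μ (Y 0) γY' ∧
        Summable fun n : ℕ =>
          (P n).mesh ^ (2 * min γX γY) + (n : ℝ)⁻¹ * (P n).mesh ^ min γX' γY') :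
    ∀ᵐ ω ∂μ, Tendsto
      (fun n : ℕ => DistCov.mallows
        -- the law of `U_n(Z)`
        (μ.map fun ω' => DistCov.uStat
          (μ.map fun ω'' => DistCov.pathPair (fun t => X 0 t ω'') (fun t => Y 0 t ω'')) n
          (fun i => DistCov.pathPair (fun t => X i t ω') (fun t => Y i t ω')))
        -- the law of the bootstrap version, given the realization `ω` of the sample
        (DistCov.bootstrapLaw fun i : Fin n => DistCov.pathPair
          ((P n).discretize fun t => X i t ω) ((P n).discretize fun t => Y i t ω)))
      atTop (𝓝 0) := by
  open DistCov in
  set γ := min γX γY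
  set W : ℕ → Ω → unitInterval → ℝ × ℝ := fun i ω t => (X i t ω, Y i t ω)
  set Z : ℕ → Ω → PathPair := fun i ω => pathPair (fun t => X i t ω) (fun t => Y i t ω)
  set r : ℕ → ℝ := fun n => (P n).mesh ^ γ
  have hr0 : ∀ n, 0 ≤ r n := fun n => Real.rpow_nonneg (P n).mesh_nonneg _
  have hr2 : ∀ n, (P n).mesh ^ (2 * γ) = r n ^ 2 := fun n => by
    rw [mul_comm, Real.rpow_mul (P n).mesh_nonneg, Real.rpow_ofNat]
  have hWm : ∀ i, Measurable (W i) := fun i => measurable_pi_lambda _ fun t =>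
    ((hXmeas i).comp measurable_prodMk_left).prodMk ((hYmeas i).comp measurable_prodMk_left)
  -- In case (b) only the squares of r are summable, which still forces r to 0.
  have hrlim : Tendsto r atTop (𝓝 0) := by
    rcases hδ with h | ⟨γX', γY', -, -, -, -, h⟩
    · exact h.tendsto_atTop_zero
    · have hs : Summable fun n => r n ^ 2 := by
        refine h.of_nonneg_of_le (fun n => sq_nonneg _) fun n => ?_
        rw [hr2]
        have := Real.rpow_nonneg (P n).mesh_nonneg (min γX' γY')
        exact le_add_of_nonneg_right (by positivity)
      have h0 := hs.tendsto_atTop_zero.sqrt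
      simpa only [Real.sqrt_sq (hr0 _), Real.sqrt_zero] using h0
  have hXi : ∀ i, ∃ c : ℝ, 0 ≤ c ∧ ∀ s t : unitInterval,
      ∫⁻ ω, (‖X i s ω - X i t ω‖ₑ ^ 2) ^ 1 ∂μ ≤ ENNReal.ofReal (c * |(s : ℝ) - t| ^ γX) := by
    intro i
    obtain ⟨c, hc, hb⟩ := hXinc.exists_lintegral_le hX2 hX0
    refine ⟨c, hc, fun s t => le_trans (le_of_eq ?_) (hb s t)⟩
    exact ((hident i).comp (u := fun w => (‖(w s).1 - (w t).1‖ₑ ^ 2) ^ 1)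
      (by fun_prop)).lintegral_eq
  have hYi : ∀ i, ∃ c : ℝ, 0 ≤ c ∧ ∀ s t : unitInterval,
      ∫⁻ ω, (‖Y i s ω - Y i t ω‖ₑ ^ 2) ^ 1 ∂μ ≤ ENNReal.ofReal (c * |(s : ℝ) - t| ^ γY) := by
    intro i
    obtain ⟨c, hc, hb⟩ := hYinc.exists_lintegral_le hY2 hY0
    refine ⟨c, hc, fun s t => le_trans (le_of_eq ?_) (hb s t)⟩
    exact ((hident i).comp (u := fun w => (‖(w s).2 - (w t).2‖ₑ ^ 2) ^ 1)
      (by fun_prop)).lintegral_eq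
  have herr : ∀ i, ∃ c : ℝ, 0 ≤ c ∧ ∀ n, ∃ g : Ω → ℝ≥0∞, Measurable g ∧
      (∀ ω, ‖Z i ω - discretePair (P n) (W i ω)‖ₑ ^ 2 ≤ g ω) ∧
      ∫⁻ ω, g ω ∂μ ≤ ENNReal.ofReal (c * r n) := by
    intro i
    obtain ⟨c, hc, hb⟩ := exists_discretization_bound (hXmeas i) (hYmeas i) (Or.inl rfl) hγX hγY
      (hXi i) (hYi i)
    refine ⟨c, hc, fun n => ?_⟩
    obtain ⟨g, hg, hle, hint⟩ := hb (P n)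
    exact ⟨g, hg, fun ω => by simpa only [pow_one] using hle ω, hint⟩
  -- From here on Ψ (W i) replaces Z i; it inherits independence and identical distribution from the
  -- trajectories.
  obtain ⟨Ψ, hΨ, hZ⟩ := exists_measurable_factor
    (fun n => measurable_discretePair (P n)) hrlim herr
  have hξm : ∀ i, Measurable fun ω => Ψ (W i ω) := fun i => hΨ.comp (hWm i)
  have hξindep : iIndepFun (fun i ω => Ψ (W i ω)) μ := hindep.comp _ fun _ => hΨ
  have hξident : ∀ i, IdentDistrib (fun ω => Ψ (W i ω)) (fun ω => Ψ (W 0 ω)) μ μ :=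
    fun i => (hident i).comp hΨ
  obtain ⟨c, hc, hc1⟩ := herr 0
  have hb1 : ∀ n, ∫⁻ ω, ‖Ψ (W 0 ω) - discretePair (P n) (W 0 ω)‖ₑ ^ 2 ∂μ
      ≤ ENNReal.ofReal (c * r n) := fun n => by
    obtain ⟨g, -, hle, hint⟩ := hc1 n
    refine (lintegral_mono_ae ?_).trans hint
    filter_upwards [hZ 0] with ω hω
    rw [← hω]
    exact hle ω
  -- Square integrability of the L² norm follows from that of a single discretization plus an error
  -- of finite mean square.
  have hL2 : MemLp (fun ω => Ψ (W 0 ω)) 2 μ := by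
    have h1 := memLp_discretePair hX2 hY2 (P 0)
    have h2 : MemLp (fun ω => Ψ (W 0 ω) - discretePair (P 0) (W 0 ω)) 2 μ :=
      memLp_of_lintegral_enorm_sq
        ((hξm 0).sub ((measurable_discretePair (P 0)).comp (hWm 0))).aestronglyMeasurable
        (ne_top_of_le_ne_top ENNReal.ofReal_ne_top (hb1 0))
    refine (h2.add h1).ae_eq (Eventually.of_forall fun ω => ?_)
    simp [W]
  have havg := ae_tendsto_average_zero (μ := μ) hWm (fun i j hij => hindep.indepFun hij) hident
    (b := fun n w => ‖Ψ w - discretePair (P n) w‖ₑ ^ 2)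
    (fun n => ((hΨ.sub (measurable_discretePair (P n))).enorm.pow_const 2)) hr0 hc hb1 (by
      rcases hδ with h | ⟨γX', γY', hγX', hγY', hX4, hY4, h⟩
      · exact Or.inl h
      · obtain ⟨c', hc', hb⟩ := exists_discretization_bound (hXmeas 0) (hYmeas 0) (Or.inr rfl)
          hγX' hγY' hX4.exists_lintegral_le hY4.exists_lintegral_le
        refine Or.inr ⟨fun n => (P n).mesh ^ min γX' γY', c',
          fun n => Real.rpow_nonneg (P n).mesh_nonneg _, hc', fun n => ?_, ?_⟩
        · obtain ⟨g, -, hle, hint⟩ := hb (P n)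
          refine (lintegral_mono_ae ?_).trans hint
          filter_upwards [hZ 0] with ω hω
          rw [← hω]
          exact hle ω
        · simpa only [hr2] using h)
  have hcoupling := ae_exists_coupling_empiricalLaw hξm (fun i j hij => hξindep.indepFun hij)
    hξident hL2 (fun n i ω => discretePair (P n) (W i ω)) havg
  set F := μ.map fun ω => Ψ (W 0 ω)
  have hFp : IsProbabilityMeasure F := Measure.isProbabilityMeasure_map (hξm 0).aemeasurable
  have hF : MemLp (fun v : PathPair => v) 2 F :=
    (memLp_map_measure_iff aestronglyMeasurable_id (hξm 0).aemeasurable).2 hL2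
  have hlaw := map_uStat_eq hZ hξm hξindep hξident
  filter_upwards [hcoupling] with ω hω
  rw [ENNReal.tendsto_nhds_zero]
  intro ε hε
  set K := 8 * ∫ v, ‖v‖ ^ 2 ∂F + 2
  have hcont : Tendsto (fun η : ℝ => ENNReal.ofReal (2 * (64 ^ 5 * η * K)) ^ (1 / 2 : ℝ))
      (𝓝[>] 0) (𝓝 0) := by
    have h : Continuous fun η : ℝ => ENNReal.ofReal (2 * (64 ^ 5 * η * K)) ^ (1 / 2 : ℝ) :=
      ENNReal.continuous_rpow_const.comp (ENNReal.continuous_ofReal.comp (by fun_prop))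
    have h0 := h.tendsto 0
    simp only [mul_zero, zero_mul, ENNReal.ofReal_zero] at h0
    rw [ENNReal.zero_rpow_of_pos (by norm_num)] at h0
    exact h0.mono_left nhdsWithin_le_nhds
  -- The bound is independent of n: η is fixed from ε first, and couplings of cost at most η exist
  -- for all large n.
  obtain ⟨η, hηε, hη0, hη1⟩ := ((hcont.eventually_le_const hε).and
    (Ioc_mem_nhdsGT zero_lt_one)).exists
  filter_upwards [hω (ENNReal.ofReal η) (by simpa using hη0), eventually_gt_atTop 0] with n hn hn0
  obtain ⟨π, h1, h2, h3⟩ := hn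
  rw [hlaw n]
  exact (mallows_uStat_le_of_cost hF h1 h2 hη0.le hη1 h3 hn0.ne').trans hηε
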